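/- **Data.** Let $N,L\ge 2$ be integers, $F=\gcd(N,L)$, $J=\mathrm{lcm}(N,L)$; let $h\in\mathbb C\setminus\{0\}$, $q=e^{h}$, and let $\varepsilon,M\in\mathbb C\setminus\{0\}$. For a positive integer $m$ let $\delta_m(n)=1$ if $m\mid n$ and $0$ otherwise, let $[n]_m\in\{0,\dots,m-1\}$ be the residue of $n$ modulo $m$, and let $\varepsilon_m(n)=\frac{m-1-2[n]_m}{m}$. Put $$\Omega(i,n)=2\delta_L(n)\bigl(\delta_N(i)-\delta_N(i+1)\bigr)+2\delta_L(n+1)\bigl(\delta_N(i)-\delta_N(i-1)\bigr).$$ **The algebra.** Consider variables $\psi_i(n)$, with $i$ taken modulo $N$ and $n$ modulo $2L$, with scalar commutators $$[\psi_i(n),\psi_j(m)]=\tfrac h4\,\Omega\bigl(i-j,\tfrac{n-m-1}2\bigr)\ (n\text{ even},\ m\text{ odd}),\qquad [\psi_i(n),\psi_j(m)]=0\ (n\equiv m \bmod 2),$$ subject to the central constraints $u(n)=0$ $(1\le n\le 2L)$ and $v(k)=0$ $(1\le k\le 2F)$, where $$u(n)=\sum_{i=1}^N\psi_i(n),\qquad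 v\bigl(2k-\tfrac{1\pm1}2\bigr)=\sum_{i=1}^N\sum_{n=1}^L\psi_i\bigl(2n-\tfrac{1\pm1}2\bigr)\,\delta_F(i+n-k)\quad(1\le k\le F).$$ For each parity $p\in\{0,1\}$ let $E_p$ be the finite-dimensional complex vector space of joint values of the commuting variables $\psi_i(n)$, $n\equiv p\pmod 2$, satisfying these constraints. Let $C'_q(N,L)$ be the $\mathbb C$-algebra generated by the two fields of meromorphic functions (quotients of entire functions) $f(\psi)$ on $E_0$ and on $E_1$, with the following relations for all $i,m$, all $t\in\mathbb C$ and all entire $f$ on the coordinate space of the parity opposite to that of $m$: $$[f(\psi),\psi_i(m)]=(\partial_w f)(\psi),\qquad f(\psi)\,e^{t\psi_i(m)}=e^{t\psi_i(m)}\,f(\psi+t w),$$ where $w$ is the vector of the scalars $[\psi_j(n),\psi_i(m)]$, $n\not\equiv m\pmod 2$. Put $\chi_i(n)=-(\varepsilon M)^2\exp(2\psi_i(n))$. **The maps.** Let $\sigma$ be given on generators by $\sigma(\chi_i(n))=\chi_i(n)$ for $n$ even and, for $n$ odd, $$\sigma(\chi_i(n))=q^2(\varepsilon M)^4\chi_i(n)\,\frac{1-q^{-2}\chi_i^{-1}(n+1)}{1-\chi_{i-1}(n+1)}\,\frac{1-q^{-2}\chi_i^{-1}(n-1)}{1-\chi_{i+1}(n-1)}.$$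 Let $\kappa_\pm$ be given on generators by $\kappa_\pm(\chi_i(n\mp1))=\chi_i(n)$ for $n$ even and, for $n$ odd, $$\kappa_\pm(\chi_i(n\mp1))=q^{-2}\,\frac{1-\chi_{i-1}(n+1)}{1-q^{-2}\chi_i^{-1}(n+1)}\,\frac{1-\chi_{i+1}(n-1)}{1-q^{-2}\chi_i^{-1}(n-1)}\,\chi_i^{-1}(n).$$ Let $\lambda_\pm$ be the algebra endomorphisms of $C'_q(N,L)$ that act on functions of the variables by $\psi_i(n)\mapsto-\psi_i(n\pm1)$ for $n$ even and $\psi_i(n)\mapsto\psi_i(n\pm1)$ for $n$ odd. **The element $U$.** For integers $x,y$ with $x+y$ odd let $$g(x,y)=\frac12\sum_{j=1}^{N/F}\varepsilon_J\Bigl(\frac{x-y-1}2+jL\Bigr)\,\varepsilon_N\Bigl(\frac{x+y-1}2+jL\Bigr),$$ and let $s(i,n)=g(i+2n-1,i)+g(i+2n+1,i)$, $$H(\psi)=\frac12\sum_{i,j=1}^N\sum_{m,n=1}^L s(i-j,m-n)\,\psi_i(2m)\psi_j(2n),\qquad U=\exp\bigl(H(\psi)/h\bigr)\prod_{i=1}^N\prod_{n=1}^L\Psi(\chi_i(2n)).$$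 Here $\Psi$ is any nonzero meromorphic solution of $\Psi(xq^{-2})=(1-x)\Psi(x)$, possibly multivalued in $x$: it is a quotient of two nonzero entire functions of $\log x$, the passage $x\mapsto xq^{-2}$ is $\log x\mapsto\log x-2h$, and $\log\chi_i(n)=\log(-(\varepsilon M)^2)+2\psi_i(n)$ with the principal value of the logarithm. (For $|q|<1$ an example is $\Psi(x)=\prod_{n\ge1}(1-xq^{2n})$.) **Proposition.** 1. The elements $\chi_i(n)$, $1-\chi_i(n)$, $1-q^{-2}\chi_i^{-1}(n)$ and $U$ of $C'_q(N,L)$ are invertible, and for all $i,n$ $$U^{-1}\chi_i(n)\,U=\sigma(\chi_i(n)).$$ So $\sigma$ extends to the inner automorphism $x\mapsto U^{-1}xU$ of $C'_q(N,L)$. 2. One has $\lambda_\pm(\chi_i(n))=(\varepsilon M)^4\chi_i^{-1}(n\pm1)$ for $n$ even and $\lambda_\pm(\chi_i(n))=\chi_i(n\pm1)$ for $n$ odd; $\lambda_+\circ\lambda_-=\lambda_-\circ\lambda_+=:\lambda$, with $\lambda(\chi_i(n))=(\varepsilon M)^4\chi_i^{-1}(n)$; and $\lambda_+(U)=\lambda_-(U)=:V$,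 with $VU$ invertible. 3. With $\sigma(x)=U^{-1}xU$, the maps $\sigma\circ\lambda_\pm$ are automorphisms of $C'_q(N,L)$ that take the values of $\kappa_\pm$ on the generators. Denote them by $\kappa_\pm$. They commute, and $\kappa=\kappa_+\circ\kappa_-$ satisfies $$\kappa(x)=(VU)^{-1}\lambda(x)\,VU\qquad\text{for all }x\in C'_q(N,L).$$ Trajectories, i.e. families $\chi_i(n,t)$ ($n+t$ odd, $t\in\mathbb Z$) with $\chi_i(n\pm1,t+1)=\kappa_\pm(\chi_i(n,t))$, $\chi_i(n,1)=\chi_i(n)$ for $n$ even and $\chi_i(n,0)=\chi_i(n)$ for $n$ odd, exist, and every one of them satisfies $\chi_i(n,t+2)=\kappa(\chi_i(n,t))=(VU)^{-1}\lambda(\chi_i(n,t))VU$ for all $t$, and $\chi_i(n,t+2)=(\varepsilon M)^4(VU)^{-1}\chi_i^{-1}(n,t)VU$ for $t\in\{0,1\}$. 4. For any algebra endomorphisms $\kappa_\pm$ of $C'_q(N,L)$ that take the above values on the generators, and for all $i,n$, $$\kappa_+(\kappa_-(\chi_i(n)))=\kappa_-(\kappa_+(\chi_i(n)))=(\varepsilon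 M)^4(VU)^{-1}\chi_i^{-1}(n)\,VU.$$ -/

import Mathlib

/-! ### Entire and meromorphic functions on a finite-dimensional complex space -/

/-- The algebra of entire functions on a complex normed space `V`. -/
def Entire (V : Type) [NormedAddCommGroup V] [NormedSpace ℂ V] : Subalgebra ℂ (V → ℂ) where
  carrier := {f | AnalyticOnNhd ℂ f Set.univ}
  mul_mem' hf hg := hf.mul hg
  add_mem' hf hg := hf.add hg
  algebraMap_mem' _ := analyticOnNhd_const

instance Entire.instIsDomain (V : Type) [NormedAddCommGroup V] [NormedSpace ℂ V] :
    IsDomain (Entire V) := by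
  have : NoZeroDivisors (Entire V) := by
    refine ⟨fun {f g} hfg => ?_⟩
    by_contra! hne
    obtain ⟨hf, hg⟩ := hne
    obtain ⟨x, hx⟩ : ∃ x, f.1 x ≠ 0 := by
      by_contra! hc
      exact hf (Subtype.ext (funext hc))
    have hcont : ContinuousAt f.1 x := (f.2 x (Set.mem_univ x)).continuousAt
    have hev : g.1 =ᶠ[nhds x] 0 := by
      filter_upwards [hcont.eventually_ne hx] with y hy
      have h1 : f.1 y * g.1 y = 0 := congrFun (congrArg Subtype.val hfg) y
      exact (mul_eq_zero.mp h1).resolve_left hy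
    have h0 := AnalyticOnNhd.eqOn_zero_of_preconnected_of_eventuallyEq_zero g.2
      isPreconnected_univ (Set.mem_univ x) hev
    exact hg (Subtype.ext (funext fun y => h0 (Set.mem_univ y)))
  exact NoZeroDivisors.to_isDomain _

/-- Meromorphic functions on `V`, as quotients of entire functions. -/
def Mer (V : Type) [NormedAddCommGroup V] [NormedSpace ℂ V] : Type :=
  FractionRing (Entire V)

noncomputable section

namespace Mer

variable (V : Type) [NormedAddCommGroup V] [NormedSpace ℂ V]

instance instField : Field (Mer V) := inferInstanceAs (Field (FractionRing (Entire V)))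

instance instAlgebraEntire : Algebra (Entire V) (Mer V) :=
  inferInstanceAs (Algebra (Entire V) (FractionRing (Entire V)))

instance instAlgebra : Algebra ℂ (Mer V) :=
  inferInstanceAs (Algebra ℂ (FractionRing (Entire V)))

instance instIsScalarTower : IsScalarTower ℂ (Entire V) (Mer V) :=
  IsScalarTower.of_algebraMap_eq fun _ => rfl

instance instIsFractionRing : IsFractionRing (Entire V) (Mer V) :=
  inferInstanceAs (IsFractionRing (Entire V) (FractionRing (Entire V)))

end Mer

namespace Entire

variable {V : Type} [NormedAddCommGroup V] [NormedSpace ℂ V]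

/-- The translate `x ↦ f (x + w)` of an entire function. -/
def translate (w : V) (f : Entire V) : Entire V :=
  ⟨fun x => f.1 (x + w), fun x _ =>
    AnalyticAt.fun_comp (f.2 (x + w) (Set.mem_univ _)) (analyticAt_id.add analyticAt_const)⟩

/-- The derivative of an entire function in the direction `w`. -/
def deriv (w : V) (f : Entire V) : Entire V :=
  ⟨fun x => fderiv ℂ f.1 x w, fun x _ =>
    ((ContinuousLinearMap.apply ℂ ℂ w).analyticAt _).fun_comp
      (AnalyticOnNhd.fderiv f.2 x (Set.mem_univ _))⟩

/-- The composition `G ∘ f` with an entire function `G` of one variable. -/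
def comp (G : ℂ → ℂ) (hG : Differentiable ℂ G) (f : Entire V) : Entire V :=
  ⟨fun x => G (f.1 x), fun x hx =>
    AnalyticAt.fun_comp (hG.analyticAt (f.1 x)) (f.2 x hx)⟩

/-- The exponential of an entire function. -/
def exp (f : Entire V) : Entire V := comp Complex.exp Complex.differentiable_exp f

/-- The pull-back `f ↦ f ∘ T` along a linear automorphism `T`. -/
def pull (T : V ≃L[ℂ] V) : Entire V ≃ₐ[ℂ] Entire V where
  toFun f := ⟨fun x => f.1 (T x), fun x _ =>
    AnalyticAt.fun_comp (f.2 (T x) (Set.mem_univ _)) (T.toContinuousLinearMap.analyticAt x)⟩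
  invFun f := ⟨fun x => f.1 (T.symm x), fun x _ =>
    AnalyticAt.fun_comp (f.2 (T.symm x) (Set.mem_univ _))
      (T.symm.toContinuousLinearMap.analyticAt x)⟩
  left_inv f := by ext x; simp
  right_inv f := by ext x; simp
  map_mul' _ _ := rfl
  map_add' _ _ := rfl
  commutes' _ := rfl

end Entire

/-- The pull-back of meromorphic functions along a linear automorphism. -/
def Mer.pull {V : Type} [NormedAddCommGroup V] [NormedSpace ℂ V] (T : V ≃L[ℂ] V) :
    Mer V ≃ₐ[ℂ] Mer V :=
  IsFractionRing.algEquivOfAlgEquiv (Entire.pull T)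

namespace Toda

/-! ### Arithmetic functions -/

/-- `δ_m(n)`: one if `n ≡ 0 (mod m)`, zero otherwise. -/
def delta (m : ℕ) (n : ℤ) : ℂ := if (n : ZMod m) = 0 then 1 else 0

/-- `ε_m(n) = (m - 1 - 2 [n]_m) / m`. -/
def eps (m : ℕ) (n : ℤ) : ℂ := ((m : ℂ) - 1 - 2 * ((n % (m : ℤ) : ℤ) : ℂ)) / m

/-- `Ω(i, n)`. -/
def Omega (N L : ℕ) (i n : ℤ) : ℂ :=
  2 * delta L n * (delta N i - delta N (i + 1)) +
    2 * delta L (n + 1) * (delta N i - delta N (i - 1))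

/-- `g(x, y)`; it is only used when `x + y` is odd, so that both halves are integers. -/
def g (N L : ℕ) (x y : ℤ) : ℂ :=
  1 / 2 * ∑ j ∈ Finset.Icc 1 (N / Nat.gcd L N),
    eps (Nat.lcm L N) ((x - y - 1) / 2 + (j : ℤ) * L) * eps N ((x + y - 1) / 2 + (j : ℤ) * L)

/-- `s(i, n) = g(i + 2n - 1, i) + g(i + 2n + 1, i)`. -/
def s (N L : ℕ) (i n : ℤ) : ℂ := g N L (i + 2 * n - 1) i + g N L (i + 2 * n + 1) i

/-- The scalar `[ψ_i(n), ψ_j(m)]`, where `q = exp h`. -/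
def bracket (N L : ℕ) (h : ℂ) (i n j m : ℤ) : ℂ :=
  if Even n ∧ Odd m then h / 4 * Omega N L (i - j) ((n - m - 1) / 2)
  else if Odd n ∧ Even m then -(h / 4 * Omega N L (j - i) ((m - n - 1) / 2))
  else 0

/-! ### The constrained commuting coordinates of one parity

The sites `n` of parity `p ∈ {0, 1}` are written `n = 2 k - p` with `k` modulo `L`. A point of
`Phase N L` is a joint value `x (i, k)` of the commuting variables `ψ_i(2 k - p)`, for a fixed `p`,
on which the central elements `u(2 k - p)` and `v(2 k - p)` vanish. -/

/-- The joint zero set of the central elements `u` and `v` of one parity. -/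
def Phase (N L : ℕ) [NeZero N] [NeZero L] : Submodule ℂ (ZMod N × ZMod L → ℂ) where
  carrier := {x | (∀ k : ZMod L, ∑ i : ZMod N, x (i, k) = 0) ∧
    ∀ r : ℤ, ∑ i : ZMod N, ∑ k : ZMod L,
      x (i, k) * delta (Nat.gcd L N) ((i.val : ℤ) + (k.val : ℤ) - r) = 0}
  add_mem' := by
    rintro x y ⟨hx, hx'⟩ ⟨hy, hy'⟩
    refine ⟨fun k => ?_, fun r => ?_⟩
    · simp [Finset.sum_add_distrib, hx k, hy k]
    · simp only [Pi.add_apply, add_mul, Finset.sum_add_distrib, hx' r, hy' r, add_zero]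
  zero_mem' := by simp
  smul_mem' := by
    rintro c x ⟨hx, hx'⟩
    refine ⟨fun k => ?_, fun r => ?_⟩
    · simp [← Finset.mul_sum, hx k]
    · simp only [Pi.smul_apply, smul_eq_mul, mul_assoc, ← Finset.mul_sum, hx' r, mul_zero]

/-- For a site `n = 2 k - p` with `p ∈ {0, 1}`, the integer `k`. -/
def half (n : ℤ) : ℤ := (n + 1) / 2

/-- The linear function `ψ_i(n)` on the coordinate space of the parity of `n`. -/
def psiFun (N L : ℕ) [NeZero N] [NeZero L] (i n : ℤ) : Entire (Phase N L) :=
  ⟨fun x => x.1 ((i : ZMod N), (half n : ZMod L)), fun x _ =>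
    (((ContinuousLinearMap.proj ((i : ZMod N), (half n : ZMod L)) :
      (ZMod N × ZMod L → ℂ) →L[ℂ] ℂ).comp (Phase N L).subtypeL).analyticAt x)⟩

theorem delta_val_sub (N : ℕ) [NeZero N] (i : ZMod N) (a : ℤ) :
    delta N ((i.val : ℤ) - a) = if i = (a : ZMod N) then 1 else 0 := by
  simp [delta, sub_eq_zero]

theorem delta_congr {m : ℕ} {a b : ℤ} (h : (a : ZMod m) = (b : ZMod m)) :
    delta m a = delta m b := by
  simp [delta, h]

theorem delta_neg (m : ℕ) (a : ℤ) : delta m (-a) = delta m a := by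
  simp [delta]

theorem delta_neg' {m : ℕ} {a b : ℤ} (h : a = -b) : delta m a = delta m b := by
  rw [h, delta_neg]

theorem cast_val_dvd {m n : ℕ} [NeZero n] (h : m ∣ n) (a : ℤ) :
    (((a : ZMod n).val : ℤ) : ZMod m) = (a : ZMod m) := by
  have := ZMod.cast_intCast (R := ZMod m) h a
  rw [← this, ZMod.cast_eq_val, Int.cast_natCast]

theorem Omega_congr {N L : ℕ} {i i' n n' : ℤ} (hi : (i : ZMod N) = (i' : ZMod N))
    (hn : (n : ZMod L) = (n' : ZMod L)) : Omega N L i n = Omega N L i' n' := by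
  have h1 : ((i + 1 : ℤ) : ZMod N) = ((i' + 1 : ℤ) : ZMod N) := by rw [Int.cast_add, hi, Int.cast_add]
  have h2 : ((i - 1 : ℤ) : ZMod N) = ((i' - 1 : ℤ) : ZMod N) := by rw [Int.cast_sub, hi, Int.cast_sub]
  have h3 : ((n + 1 : ℤ) : ZMod L) = ((n' + 1 : ℤ) : ZMod L) := by rw [Int.cast_add, hn, Int.cast_add]
  rw [Omega, Omega, delta_congr hi, delta_congr hn, delta_congr h1, delta_congr h2, delta_congr h3]

/-- `Ω(-i, -n - 1) = Ω(i, n)`. -/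
theorem Omega_symm (N L : ℕ) (i n : ℤ) : Omega N L (-i) (-n - 1) = Omega N L i n := by
  simp only [Omega]
  rw [delta_neg' (a := -n - 1) (b := n + 1) (by ring), delta_neg' (a := -n - 1 + 1) (b := n) (by ring),
    delta_neg' (a := -i + 1) (b := i - 1) (by ring), delta_neg' (a := -i - 1) (b := i + 1) (by ring),
    delta_neg]
  ring

/-- The vectors `Ω(i - j, k - l)` satisfy the constraints. -/
theorem Omega_mem (N L : ℕ) [NeZero N] [NeZero L] (j l : ℤ) (c : ℂ) :
    (fun a : ZMod N × ZMod L => c * Omega N L ((a.1.val : ℤ) - j) ((a.2.val : ℤ) - l)) ∈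
      Phase N L := by
  have key : ∀ (a : ZMod N × ZMod L), Omega N L ((a.1.val : ℤ) - j) ((a.2.val : ℤ) - l) =
      2 * (if a.2 = (l : ZMod L) then 1 else 0) *
        ((if a.1 = (j : ZMod N) then 1 else 0) - (if a.1 = ((j - 1 : ℤ) : ZMod N) then 1 else 0)) +
      2 * (if a.2 = ((l - 1 : ℤ) : ZMod L) then 1 else 0) *
        ((if a.1 = (j : ZMod N) then 1 else 0) -
          (if a.1 = ((j + 1 : ℤ) : ZMod N) then 1 else 0)) := by
    intro a
    simp only [← delta_val_sub, Omega]
    rw [sub_add, sub_add, sub_sub]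
  refine ⟨fun k => ?_, fun r => ?_⟩
  · have key' : ∀ i : ZMod N, c * Omega N L ((i.val : ℤ) - j) ((k.val : ℤ) - l) =
        c * (2 * (if k = (l : ZMod L) then 1 else 0) * ((if i = (j : ZMod N) then 1 else 0) -
          (if i = ((j - 1 : ℤ) : ZMod N) then 1 else 0)) +
        2 * (if k = ((l - 1 : ℤ) : ZMod L) then 1 else 0) * ((if i = (j : ZMod N) then 1 else 0) -
          (if i = ((j + 1 : ℤ) : ZMod N) then 1 else 0))) :=
      fun i => congrArg (c * ·) (key (i, k))
    rw [Finset.sum_congr rfl fun i _ => key' i]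
    rw [← Finset.mul_sum, Finset.sum_add_distrib, ← Finset.mul_sum, ← Finset.mul_sum,
      Finset.sum_sub_distrib, Finset.sum_sub_distrib]
    simp
  · have e1 : ∀ (a b : ℤ), (∑ i : ZMod N, ∑ k : ZMod L,
        ((if k = (b : ZMod L) then (1 : ℂ) else 0) * (if i = (a : ZMod N) then 1 else 0)) *
          delta (Nat.gcd L N) ((i.val : ℤ) + (k.val : ℤ) - r)) =
          delta (Nat.gcd L N) (a + b - r) := by
      intro a b
      rw [Finset.sum_eq_single (a : ZMod N), Finset.sum_eq_single (b : ZMod L)]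
      · simp only [if_true, one_mul]
        apply delta_congr
        have h1 := cast_val_dvd (Nat.gcd_dvd_right L N) a
        have h2 := cast_val_dvd (Nat.gcd_dvd_left L N) b
        rw [Int.cast_sub, Int.cast_add, h1, h2]
        push_cast
        rfl
      · intro k _ hk
        simp [hk]
      · simp
      · intro i _ hi
        simp [hi]
      · simp
    have e2 : ∀ (i : ZMod N) (k : ZMod L),
        c * Omega N L ((i.val : ℤ) - j) ((k.val : ℤ) - l) *
          delta (Nat.gcd L N) ((i.val : ℤ) + (k.val : ℤ) - r) =
        2 * c * (((if k = (l : ZMod L) then (1 : ℂ) else 0) *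
            (if i = (j : ZMod N) then 1 else 0)) *
              delta (Nat.gcd L N) ((i.val : ℤ) + (k.val : ℤ) - r)) -
        2 * c * (((if k = (l : ZMod L) then (1 : ℂ) else 0) *
            (if i = ((j - 1 : ℤ) : ZMod N) then 1 else 0)) *
              delta (Nat.gcd L N) ((i.val : ℤ) + (k.val : ℤ) - r)) +
        2 * c * (((if k = ((l - 1 : ℤ) : ZMod L) then (1 : ℂ) else 0) *
            (if i = (j : ZMod N) then 1 else 0)) *
              delta (Nat.gcd L N) ((i.val : ℤ) + (k.val : ℤ) - r)) -
        2 * c * (((if k = ((l - 1 : ℤ) : ZMod L) then (1 : ℂ) else 0) *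
            (if i = ((j + 1 : ℤ) : ZMod N) then 1 else 0)) *
              delta (Nat.gcd L N) ((i.val : ℤ) + (k.val : ℤ) - r)) := by
      intro i k
      rw [key (i, k)]
      ring
    simp only [e2, Finset.sum_add_distrib, Finset.sum_sub_distrib, ← Finset.mul_sum, e1]
    rw [show j + (l - 1) - r = j - 1 + l - r by ring, show j + 1 + (l - 1) - r = j + l - r by ring]
    ring

theorem bracket_even (N L : ℕ) (h : ℂ) (i n j m : ℤ) (hm : Even m) :
    bracket N L h i (2 * n - 1) j m = -(h / 4) * Omega N L (i - j) (n - m / 2 - 1) := by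
  obtain ⟨t, rfl⟩ := hm
  have h1 : Odd (2 * n - 1) := ⟨n - 1, by ring⟩
  have h2 : Even (t + t) := ⟨t, rfl⟩
  rw [bracket, if_neg (by simp [Int.not_even_iff_odd.mpr h1]), if_pos ⟨h1, h2⟩,
    ← Omega_symm N L (i - j)]
  rw [show -(i - j) = j - i by ring,
    show (t + t - (2 * n - 1) - 1) / 2 = -(n - (t + t) / 2 - 1) - 1 by omega]
  ring

theorem bracket_odd (N L : ℕ) (h : ℂ) (i n j m : ℤ) (hm : Odd m) :
    bracket N L h i (2 * n) j m = h / 4 * Omega N L (i - j) (n - (m + 1) / 2) := by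
  obtain ⟨t, rfl⟩ := hm
  rw [bracket, if_pos ⟨even_two_mul n, ⟨t, rfl⟩⟩]
  rw [show (2 * n - (2 * t + 1) - 1) / 2 = n - (2 * t + 1 + 1) / 2 by omega]

/-- The vector with entries `[ψ_i(2 k - p), ψ_j(m)]`, where `p` is the parity opposite to that
of `m`. -/
def bracketVec (N L : ℕ) [NeZero N] [NeZero L] (h : ℂ) (j m : ℤ) : Phase N L :=
  ⟨fun a => bracket N L h a.1.val (2 * (a.2.val : ℤ) - (((m : ZMod 2) + 1).val : ℤ)) j m, by
    rcases Int.even_or_odd m with hm | hm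
    · have hp : (((m : ZMod 2) + 1).val : ℤ) = 1 := by
        rw [(ZMod.intCast_eq_zero_iff_even).mpr hm]; rfl
      convert Omega_mem N L j (m / 2 + 1) (-(h / 4)) using 2 with a
      rw [hp, bracket_even _ _ _ _ _ _ _ hm, sub_sub]
    · have hp : (((m : ZMod 2) + 1).val : ℤ) = 0 := by
        rw [(ZMod.intCast_eq_one_iff_odd).mpr hm]; rfl
      convert Omega_mem N L j ((m + 1) / 2) (h / 4) using 2 with a
      rw [hp, sub_zero, bracket_odd _ _ _ _ _ _ _ hm]⟩

/-! ### The algebra -/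

/-- The defining relations: the symbol `(p, f)` stands for the function `f` of the commuting
variables `ψ_i(n)` with `n` of parity `p`. -/
inductive Rel (N L : ℕ) [NeZero N] [NeZero L] (h : ℂ) :
    FreeAlgebra ℂ (ZMod 2 × Mer (Phase N L)) → FreeAlgebra ℂ (ZMod 2 × Mer (Phase N L)) → Prop
  | add (p : ZMod 2) (a b : Mer (Phase N L)) :
      Rel N L h (FreeAlgebra.ι ℂ (p, a + b)) (FreeAlgebra.ι ℂ (p, a) + FreeAlgebra.ι ℂ (p, b))
  | mul (p : ZMod 2) (a b : Mer (Phase N L)) :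
      Rel N L h (FreeAlgebra.ι ℂ (p, a * b)) (FreeAlgebra.ι ℂ (p, a) * FreeAlgebra.ι ℂ (p, b))
  | scalar (p : ZMod 2) (c : ℂ) :
      Rel N L h (FreeAlgebra.ι ℂ (p, algebraMap ℂ _ c)) (algebraMap ℂ _ c)
  /-- `[f(ψ), ψ_j(m)] = (∂_w f)(ψ)` with `w = [ψ, ψ_j(m)]`. -/
  | commutator (j m : ℤ) (f : Entire (Phase N L)) :
      Rel N L h
        (FreeAlgebra.ι ℂ ((m : ZMod 2) + 1, algebraMap _ _ f) *
          FreeAlgebra.ι ℂ ((m : ZMod 2), algebraMap _ _ (psiFun N L j m)))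
        (FreeAlgebra.ι ℂ ((m : ZMod 2), algebraMap _ _ (psiFun N L j m)) *
          FreeAlgebra.ι ℂ ((m : ZMod 2) + 1, algebraMap _ _ f) +
          FreeAlgebra.ι ℂ ((m : ZMod 2) + 1, algebraMap _ _ (Entire.deriv (bracketVec N L h j m) f)))
  /-- `f(ψ) exp(t ψ_j(m)) = exp(t ψ_j(m)) f(ψ + t w)` with `w = [ψ, ψ_j(m)]`. -/
  | exchange (j m : ℤ) (t : ℂ) (f : Entire (Phase N L)) :
      Rel N L h
        (FreeAlgebra.ι ℂ ((m : ZMod 2) + 1, algebraMap _ _ f) *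
          FreeAlgebra.ι ℂ ((m : ZMod 2), algebraMap _ _ (Entire.exp (t • psiFun N L j m))))
        (FreeAlgebra.ι ℂ ((m : ZMod 2), algebraMap _ _ (Entire.exp (t • psiFun N L j m))) *
          FreeAlgebra.ι ℂ ((m : ZMod 2) + 1,
            algebraMap _ _ (Entire.translate (t • bracketVec N L h j m) f)))

/-- The completed algebra `C'_q(N, L)`, `q = exp h`, with the central constraints imposed. It is
generated by the meromorphic functions of the `ψ_i(n)` with `n` even and those of the `ψ_i(n)` with
`n` odd. -/
abbrev Cq (N L : ℕ) [NeZero N] [NeZero L] (h : ℂ) : Type := RingQuot (Rel N L h)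

section Algebra

variable (N L : ℕ) [NeZero N] [NeZero L] (h : ℂ)

/-- The function `f(ψ)` of the commuting variables of parity `p`, as an element of the algebra. -/
def fn (p : ZMod 2) : Mer (Phase N L) →ₐ[ℂ] Cq N L h :=
  AlgHom.ofLinearMap
    { toFun := fun f => RingQuot.mkAlgHom ℂ (Rel N L h) (FreeAlgebra.ι ℂ (p, f))
      map_add' := fun a b => by
        rw [← map_add]
        exact RingQuot.mkAlgHom_rel ℂ (Rel.add p a b)
      map_smul' := fun c a => by
        rw [Algebra.smul_def, RingQuot.mkAlgHom_rel ℂ (Rel.mul p _ a), map_mul,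
          RingQuot.mkAlgHom_rel ℂ (Rel.scalar p c), AlgHom.commutes, RingHom.id_apply,
          Algebra.smul_def] }
    (by
      have := RingQuot.mkAlgHom_rel ℂ (Rel.scalar (N := N) (L := L) (h := h) p 1)
      simpa using this)
    (fun a b => by
      have := RingQuot.mkAlgHom_rel ℂ (Rel.mul (h := h) p a b)
      rw [map_mul] at this
      exact this)

/-- The generator `ψ_i(n)`, for all integers `i`, `n` (modulo `N` and `2 L`). -/
def psi (i n : ℤ) : Cq N L h := fn N L h (n : ZMod 2) (algebraMap _ _ (psiFun N L i n))

/-- The generator `χ_i(n) = -(ε M)² exp(2 ψ_i(n))`. -/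
def chi (ε M : ℂ) (i n : ℤ) : Cq N L h :=
  -((ε * M) ^ 2) • fn N L h (n : ZMod 2) (algebraMap _ _ (Entire.exp ((2 : ℂ) • psiFun N L i n)))

theorem fn_commutator (j m : ℤ) (f : Entire (Phase N L)) :
    fn N L h ((m : ZMod 2) + 1) (algebraMap _ _ f) * psi N L h j m =
      psi N L h j m * fn N L h ((m : ZMod 2) + 1) (algebraMap _ _ f) +
        fn N L h ((m : ZMod 2) + 1) (algebraMap _ _ (Entire.deriv (bracketVec N L h j m) f)) := by
  have := RingQuot.mkAlgHom_rel ℂ (Rel.commutator (h := h) j m f)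
  rw [map_mul, map_add, map_mul] at this
  exact this

theorem fn_exchange (j m : ℤ) (t : ℂ) (f : Entire (Phase N L)) :
    fn N L h ((m : ZMod 2) + 1) (algebraMap _ _ f) *
        fn N L h (m : ZMod 2) (algebraMap _ _ (Entire.exp (t • psiFun N L j m))) =
      fn N L h (m : ZMod 2) (algebraMap _ _ (Entire.exp (t • psiFun N L j m))) *
        fn N L h ((m : ZMod 2) + 1)
          (algebraMap _ _ (Entire.translate (t • bracketVec N L h j m) f)) := by
  have := RingQuot.mkAlgHom_rel ℂ (Rel.exchange (h := h) j m t f)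
  rw [map_mul, map_mul] at this
  exact this

end Algebra

/-! ### The maps `λ_±` -/

/-- The translation `x (i, k) ↦ x (i, k + c)`. -/
def shiftEquiv (N L : ℕ) [NeZero N] [NeZero L] (c : ZMod L) : Phase N L ≃ₗ[ℂ] Phase N L :=
  have key : ∀ (c : ZMod L) (x : ZMod N × ZMod L → ℂ), x ∈ Phase N L →
      (fun a : ZMod N × ZMod L => x (a.1, a.2 + c)) ∈ Phase N L := by
    rintro c x ⟨hx, hx'⟩
    refine ⟨fun k => hx (k + c), fun r => ?_⟩
    rw [← hx' (r + c.val)]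
    refine Finset.sum_congr rfl fun i _ => ?_
    refine Fintype.sum_equiv (Equiv.addRight c) _ _ fun k => ?_
    have hd : (((k + c : ZMod L).val : ℤ) : ZMod (Nat.gcd L N)) =
        (((k.val : ℤ) + (c.val : ℤ) : ℤ) : ZMod (Nat.gcd L N)) := by
      have h1 := cast_val_dvd (Nat.gcd_dvd_left L N) ((k.val : ℤ) + (c.val : ℤ))
      simpa using h1
    simp only [Equiv.coe_addRight]
    congr 1
    apply delta_congr
    rw [Int.cast_sub, Int.cast_add, Int.cast_sub, Int.cast_add ((i.val : ℤ)), hd]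
    push_cast
    ring
  { toFun := fun x => ⟨fun a => x.1 (a.1, a.2 + c), key c x.1 x.2⟩
    invFun := fun x => ⟨fun a => x.1 (a.1, a.2 + -c), key (-c) x.1 x.2⟩
    left_inv := fun x => by ext a; simp
    right_inv := fun x => by ext a; simp
    map_add' := fun _ _ => rfl
    map_smul' := fun _ _ => rfl }

/-- The map on coordinates behind `λ_e`, `e = ±1`. The site `n = 2 k - p` goes to
`n + e = 2 k' - p'` with `p'` the other parity, and `ψ_i(n) ↦ -ψ_i(n + e)` for `n` even,
`ψ_i(n) ↦ ψ_i(n + e)` for `n` odd. -/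
def lamEquiv (N L : ℕ) [NeZero N] [NeZero L] (e : ℤˣ) (p : ZMod 2) : Phase N L ≃L[ℂ] Phase N L :=
  ((shiftEquiv N L ((((e : ℤ) - (p.val : ℤ) + ((p + 1).val : ℤ)) / 2 : ℤ) : ZMod L)).trans
    (if p = 0 then LinearEquiv.neg ℂ else LinearEquiv.refl ℂ _)).toContinuousLinearEquiv

theorem bracket_shift (N L : ℕ) (h : ℂ) (i n j m : ℤ) (e : ℤˣ) :
    bracket N L h i (n + e) j (m + e) = -bracket N L h i n j m := by
  have he : Odd (e : ℤ) := by
    rcases Int.units_eq_one_or e with rfl | rfl <;> decide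
  have h1 : ∀ a : ℤ, Even (a + e) ↔ Odd a := fun a => by
    rw [Int.even_add, ← Int.not_even_iff_odd]
    simp [Int.not_even_iff_odd.mpr he]
  have h2 : ∀ a : ℤ, Odd (a + e) ↔ Even a := fun a => by
    rw [← Int.not_even_iff_odd, h1, Int.not_odd_iff_even]
  simp only [bracket, h1, h2]
  rcases Int.even_or_odd n with hn | hn <;> rcases Int.even_or_odd m with hm | hm
  · simp [hn, hm, Int.not_odd_iff_even.mpr hn, Int.not_odd_iff_even.mpr hm]
  · simp only [hn, hm, Int.not_odd_iff_even.mpr hn, Int.not_even_iff_odd.mpr hm, and_self,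
      if_true, if_false]
    rw [← Omega_symm N L (i - j), show -(i - j) = j - i by ring,
      show m + (e : ℤ) - (n + e) - 1 = m - n - 1 by ring]
    rw [show (m - n - 1) / 2 = -((n - m - 1) / 2) - 1 by
      obtain ⟨a, rfl⟩ := hn; obtain ⟨b, rfl⟩ := hm; omega]
  · simp only [hn, hm, Int.not_even_iff_odd.mpr hn, Int.not_odd_iff_even.mpr hm, and_self,
      if_true, if_false]
    rw [← Omega_symm N L (j - i), show -(j - i) = i - j by ring,
      show n + (e : ℤ) - (m + e) - 1 = n - m - 1 by ring]
    rw [show (n - m - 1) / 2 = -((m - n - 1) / 2) - 1 by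
      obtain ⟨a, rfl⟩ := hn; obtain ⟨b, rfl⟩ := hm; omega, neg_neg]
  · simp [hn, hm, Int.not_even_iff_odd.mpr hn, Int.not_even_iff_odd.mpr hm]

/-- The bracket is periodic in the spatial argument. -/
theorem bracket_congr {N L : ℕ} (h : ℂ) (i j m : ℤ) {k k' p : ℤ}
    (hk : (k : ZMod L) = (k' : ZMod L)) (hp : p = 0 ∧ Odd m ∨ p = 1 ∧ Even m) :
    bracket N L h i (2 * k - p) j m = bracket N L h i (2 * k' - p) j m := by
  rcases hp with ⟨rfl, hm⟩ | ⟨rfl, hm⟩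
  · rw [sub_zero, sub_zero, bracket_odd _ _ _ _ _ _ _ hm, bracket_odd _ _ _ _ _ _ _ hm]
    rw [Omega_congr (N := N) (i := i - j) rfl (n' := k' - (m + 1) / 2)]
    rw [Int.cast_sub, hk, Int.cast_sub]
  · rw [bracket_even _ _ _ _ _ _ _ hm, bracket_even _ _ _ _ _ _ _ hm]
    rw [Omega_congr (N := N) (i := i - j) rfl (n' := k' - m / 2 - 1)]
    rw [Int.cast_sub, Int.cast_sub, hk, Int.cast_sub, Int.cast_sub]

theorem lamEquiv_apply (N L : ℕ) [NeZero N] [NeZero L] (e : ℤˣ) (p : ZMod 2) (x : Phase N L)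
    (a : ZMod N × ZMod L) :
    (lamEquiv N L e p x).1 a = (if p = 0 then (-1 : ℂ) else 1) *
      x.1 (a.1, a.2 + ((((e : ℤ) - (p.val : ℤ) + ((p + 1).val : ℤ)) / 2 : ℤ) : ZMod L)) := by
  by_cases hp : p = 0
  · simp [lamEquiv, shiftEquiv, hp]
  · simp [lamEquiv, shiftEquiv, hp]

theorem odd_unit (e : ℤˣ) : Odd (e : ℤ) := by
  rcases Int.units_eq_one_or e with rfl | rfl <;> decide

theorem lamEquiv_bracketVec (N L : ℕ) [NeZero N] [NeZero L] (h : ℂ) (e : ℤˣ) (j m : ℤ) :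
    lamEquiv N L e ((m : ZMod 2) + 1) (bracketVec N L h j (m + e)) =
      (if (m : ZMod 2) = 0 then (-1 : ℂ) else 1) • bracketVec N L h j m := by
  obtain ⟨d, hd⟩ := odd_unit e
  ext a
  rw [lamEquiv_apply]
  rcases Int.even_or_odd m with hm | hm
  · have hp : (m : ZMod 2) = 0 := (ZMod.intCast_eq_zero_iff_even).mpr hm
    have hp' : ((m + e : ℤ) : ZMod 2) = 1 :=
      (ZMod.intCast_eq_one_iff_odd).mpr (hm.add_odd (odd_unit e))
    have hc : ((((e : ℤ) - (((1 : ZMod 2)).val : ℤ) + (((1 : ZMod 2) + 1).val : ℤ)) / 2 : ℤ)) = d := by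
      rw [show ((1 : ZMod 2)).val = 1 from rfl, show ((1 : ZMod 2) + 1).val = 0 from rfl, hd]
      omega
    simp only [bracketVec, hp, hp', zero_add, hc]
    simp only [Submodule.coe_smul, Pi.smul_apply, smul_eq_mul, if_true, one_ne_zero, if_false,
      one_mul]
    rw [show ((1 : ZMod 2) + 1).val = 0 from rfl, show ((1 : ZMod 2)).val = 1 from rfl]
    rw [bracket_congr h _ j (m + e) (k' := (a.2.val : ℤ) + d) (by simp)
      (Or.inl ⟨by simp, hm.add_odd (odd_unit e)⟩)]
    rw [show 2 * ((a.2.val : ℤ) + d) - ((0 : ℕ) : ℤ) = 2 * (a.2.val : ℤ) - ((1 : ℕ) : ℤ) + e by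
      rw [hd]; push_cast; ring, bracket_shift]
    ring
  · have hp : (m : ZMod 2) = 1 := (ZMod.intCast_eq_one_iff_odd).mpr hm
    have hp' : ((m + e : ℤ) : ZMod 2) = 0 :=
      (ZMod.intCast_eq_zero_iff_even).mpr (hm.add_odd (odd_unit e))
    have h0 : (1 : ZMod 2) + 1 = 0 := rfl
    have hc : ((((e : ℤ) - (((0 : ZMod 2)).val : ℤ) + (((0 : ZMod 2) + 1).val : ℤ)) / 2 : ℤ)) =
        d + 1 := by
      rw [show ((0 : ZMod 2)).val = 0 from rfl, show ((0 : ZMod 2) + 1).val = 1 from rfl, hd]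
      omega
    simp only [bracketVec, hp, hp', h0, hc]
    simp only [Submodule.coe_smul, Pi.smul_apply, smul_eq_mul, if_true, one_ne_zero, if_false,
      one_mul]
    rw [show ((0 : ZMod 2) + 1).val = 1 from rfl, show ((0 : ZMod 2)).val = 0 from rfl]
    rw [bracket_congr h _ j (m + e) (k' := (a.2.val : ℤ) + (d + 1)) (by simp)
      (Or.inr ⟨by simp, hm.add_odd (odd_unit e)⟩)]
    rw [show 2 * ((a.2.val : ℤ) + (d + 1)) - ((1 : ℕ) : ℤ) =
      2 * (a.2.val : ℤ) - ((0 : ℕ) : ℤ) + e by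
      rw [hd]; push_cast; ring, bracket_shift]
    ring

theorem pull_psiFun (N L : ℕ) [NeZero N] [NeZero L] (e : ℤˣ) (j m : ℤ) :
    Entire.pull (lamEquiv N L e (m : ZMod 2)) (psiFun N L j m) =
      (if (m : ZMod 2) = 0 then (-1 : ℂ) else 1) • psiFun N L j (m + e) := by
  obtain ⟨d, hd⟩ := odd_unit e
  ext x
  have hl : (Entire.pull (lamEquiv N L e (m : ZMod 2)) (psiFun N L j m)).1 x =
      (lamEquiv N L e (m : ZMod 2) x).1 ((j : ZMod N), (half m : ZMod L)) := rfl
  have hr : ∀ c : ℂ, (c • psiFun N L j (m + e)).1 x =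
      c * x.1 ((j : ZMod N), (half (m + e) : ZMod L)) := fun _ => rfl
  rw [hl, hr, lamEquiv_apply]
  have key : half m + ((e : ℤ) - (((m : ZMod 2)).val : ℤ) + ((((m : ZMod 2) + 1)).val : ℤ)) / 2 =
      half (m + e) := by
    rcases Int.even_or_odd m with hm | hm
    · have hp : (m : ZMod 2) = 0 := (ZMod.intCast_eq_zero_iff_even).mpr hm
      rw [hp, show ((0 : ZMod 2)).val = 0 from rfl, show ((0 : ZMod 2) + 1).val = 1 from rfl, hd]
      obtain ⟨t, rfl⟩ := hm
      simp only [half]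
      omega
    · have hp : (m : ZMod 2) = 1 := (ZMod.intCast_eq_one_iff_odd).mpr hm
      rw [hp, show ((1 : ZMod 2)).val = 1 from rfl, show ((1 : ZMod 2) + 1).val = 0 from rfl, hd]
      obtain ⟨t, rfl⟩ := hm
      simp only [half]
      omega
  rw [← key, Int.cast_add]

theorem Mer.pull_algebraMap {V : Type} [NormedAddCommGroup V] [NormedSpace ℂ V] (T : V ≃L[ℂ] V)
    (f : Entire V) : Mer.pull T (algebraMap _ _ f) = algebraMap _ _ (Entire.pull T f) :=
  IsFractionRing.algEquivOfAlgEquiv_algebraMap _ _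

theorem pull_exp {V : Type} [NormedAddCommGroup V] [NormedSpace ℂ V] (T : V ≃L[ℂ] V)
    (f : Entire V) : Entire.pull T (Entire.exp f) = Entire.exp (Entire.pull T f) := rfl

theorem pull_translate {V : Type} [NormedAddCommGroup V] [NormedSpace ℂ V] (T : V ≃L[ℂ] V)
    (f : Entire V) (w : V) :
    Entire.pull T (Entire.translate (T w) f) = Entire.translate w (Entire.pull T f) := by
  ext x
  change f.1 (T x + T w) = f.1 (T (x + w))
  rw [map_add]

theorem pull_deriv {V : Type} [NormedAddCommGroup V] [NormedSpace ℂ V] (T : V ≃L[ℂ] V)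
    (f : Entire V) (w : V) :
    Entire.pull T (Entire.deriv (T w) f) = Entire.deriv w (Entire.pull T f) := by
  ext x
  change fderiv ℂ f.1 (T x) (T w) = fderiv ℂ (f.1 ∘ T) x w
  rw [fderiv_comp x ((f.2 (T x) (Set.mem_univ _)).differentiableAt) T.differentiableAt,
    T.fderiv]
  rfl

theorem deriv_smul {V : Type} [NormedAddCommGroup V] [NormedSpace ℂ V] (c : ℂ) (w : V)
    (f : Entire V) : Entire.deriv (c • w) f = c • Entire.deriv w f := by
  ext x
  change fderiv ℂ f.1 x (c • w) = c * fderiv ℂ f.1 x w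
  simp

/-- The map `λ_e` on a function of the variables of one parity. -/
def lamFn (N L : ℕ) [NeZero N] [NeZero L] (h : ℂ) (e : ℤˣ) (p : ZMod 2) :
    Mer (Phase N L) →ₐ[ℂ] Cq N L h :=
  (fn N L h (p + 1)).comp (Mer.pull (lamEquiv N L e p)).toAlgHom

theorem algebraMap_smul' {V : Type} [NormedAddCommGroup V] [NormedSpace ℂ V] (c : ℂ)
    (f : Entire V) : algebraMap (Entire V) (Mer V) (c • f) = c • algebraMap (Entire V) (Mer V) f :=
  map_smul (IsScalarTower.toAlgHom ℂ (Entire V) (Mer V)) c f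

theorem cast_add_unit (m : ℤ) (e : ℤˣ) : ((m + e : ℤ) : ZMod 2) = (m : ZMod 2) + 1 := by
  rw [Int.cast_add, (ZMod.intCast_eq_one_iff_odd).mpr (odd_unit e)]

theorem lamFn_algebraMap (N L : ℕ) [NeZero N] [NeZero L] (h : ℂ) (e : ℤˣ) (p : ZMod 2)
    (f : Entire (Phase N L)) :
    lamFn N L h e p (algebraMap _ _ f) =
      fn N L h (p + 1) (algebraMap _ _ (Entire.pull (lamEquiv N L e p) f)) := by
  rw [← Mer.pull_algebraMap]
  rfl

theorem lamFn_psi (N L : ℕ) [NeZero N] [NeZero L] (h : ℂ) (e : ℤˣ) (j m : ℤ) :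
    lamFn N L h e (m : ZMod 2) (algebraMap _ _ (psiFun N L j m)) =
      (if (m : ZMod 2) = 0 then (-1 : ℂ) else 1) • psi N L h j (m + e) := by
  rw [lamFn_algebraMap, pull_psiFun, psi, cast_add_unit, ← map_smul, algebraMap_smul']

/-- `λ_e` respects the defining relations. -/
theorem lamFn_rel (N L : ℕ) [NeZero N] [NeZero L] (h : ℂ) (e : ℤˣ)
    {a b : FreeAlgebra ℂ (ZMod 2 × Mer (Phase N L))} (hab : Rel N L h a b) :
    FreeAlgebra.lift ℂ (fun a : ZMod 2 × Mer (Phase N L) => lamFn N L h e a.1 a.2) a =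
      FreeAlgebra.lift ℂ (fun a : ZMod 2 × Mer (Phase N L) => lamFn N L h e a.1 a.2) b := by
  cases hab with
  | add p a b => simp
  | mul p a b => simp
  | scalar p c => simp
  | commutator j m f =>
    simp only [map_mul, map_add, FreeAlgebra.lift_ι_apply]
    have hw := lamEquiv_bracketVec N L h e j m
    rw [lamFn_psi]
    simp only [lamFn_algebraMap]
    generalize hs : (if (m : ZMod 2) = 0 then (-1 : ℂ) else 1) = s at hw
    have hs2 : s * s = 1 := by rw [← hs]; split_ifs <;> norm_num
    have hw' : bracketVec N L h j m =
        lamEquiv N L e ((m : ZMod 2) + 1) (s • bracketVec N L h j (m + e)) := by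
      rw [map_smul, hw, smul_smul, hs2, one_smul]
    have hc := fn_commutator N L h j (m + e) (Entire.pull (lamEquiv N L e ((m : ZMod 2) + 1)) f)
    rw [cast_add_unit] at hc
    rw [hw', pull_deriv, deriv_smul, mul_smul_comm, hc, smul_mul_assoc, smul_add, algebraMap_smul',
      map_smul]
  | exchange j m t f =>
    simp only [map_mul, FreeAlgebra.lift_ι_apply]
    have hw := lamEquiv_bracketVec N L h e j m
    simp only [lamFn_algebraMap, pull_exp, map_smul, pull_psiFun]
    generalize hs : (if (m : ZMod 2) = 0 then (-1 : ℂ) else 1) = s at hw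
    have hs2 : s * s = 1 := by rw [← hs]; split_ifs <;> norm_num
    have hw' : t • bracketVec N L h j m =
        lamEquiv N L e ((m : ZMod 2) + 1) ((t * s) • bracketVec N L h j (m + e)) := by
      rw [map_smul, hw, smul_smul, mul_assoc, hs2, mul_one]
    have hc := fn_exchange N L h j (m + e) (t * s)
      (Entire.pull (lamEquiv N L e ((m : ZMod 2) + 1)) f)
    rw [cast_add_unit] at hc
    rw [hw', pull_translate, smul_smul, hc]

/-- The endomorphism `λ_e` (`e = 1` for `λ_+`, `e = -1` for `λ_-`), given on the functions of the
`ψ_i(n)` by `ψ_i(n) ↦ -ψ_i(n + e)` for `n` even and `ψ_i(n) ↦ ψ_i(n + e)` for `n` odd. -/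
def lam (N L : ℕ) [NeZero N] [NeZero L] (h : ℂ) (e : ℤˣ) : Cq N L h →ₐ[ℂ] Cq N L h :=
  RingQuot.liftAlgHom ℂ
    ⟨FreeAlgebra.lift ℂ (fun a : ZMod 2 × Mer (Phase N L) => lamFn N L h e a.1 a.2),
      fun _ _ hab => lamFn_rel N L h e hab⟩

/-! ### The element `U` -/

/-- A nonzero meromorphic solution `Ψ` of `Ψ(x q⁻²) = (1 - x) Ψ(x)`, `q = exp h`, on the universal
cover of `ℂ \ {0}`: as a function of `log x` it is the quotient `num / den` of two entire
functions. -/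
structure DilogSolution (h : ℂ) where
  num : ℂ → ℂ
  den : ℂ → ℂ
  num_entire : Differentiable ℂ num
  den_entire : Differentiable ℂ den
  num_ne_zero : num ≠ 0
  den_ne_zero : den ≠ 0
  equation : ∀ w : ℂ,
    num (w - 2 * h) * den w = (1 - Complex.exp w) * num w * den (w - 2 * h)

section Evolution

variable (N L : ℕ) [NeZero N] [NeZero L] (h : ℂ) (ε M : ℂ)

/-- The quadratic form `H(ψ)` in the `ψ_i(n)` with `n` even. -/
def quadForm : Entire (Phase N L) :=
  (1 / 2 : ℂ) • ∑ i ∈ Finset.Icc 1 N, ∑ j ∈ Finset.Icc 1 N, ∑ m ∈ Finset.Icc 1 L,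
    ∑ n ∈ Finset.Icc 1 L, s N L ((i : ℤ) - j) ((m : ℤ) - n) •
      (psiFun N L i (2 * (m : ℤ)) * psiFun N L j (2 * (n : ℤ)))

/-- `log χ_i(n) = log(-(ε M)²) + 2 ψ_i(n)`. -/
def logChi (i n : ℤ) : Entire (Phase N L) :=
  algebraMap ℂ _ (Complex.log (-((ε * M) ^ 2))) + (2 : ℂ) • psiFun N L i n

variable {h} in
/-- `Ψ(χ_i(n))`. -/
def dilogChi (Ψ : DilogSolution h) (i n : ℤ) : Mer (Phase N L) :=
  algebraMap _ _ (Entire.comp Ψ.num Ψ.num_entire (logChi N L ε M i n)) /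
    algebraMap _ _ (Entire.comp Ψ.den Ψ.den_entire (logChi N L ε M i n))

/-- `U = exp(H(ψ)/h) ∏ Ψ(χ_i(2n))`. -/
def evolU (Ψ : DilogSolution h) : Cq N L h :=
  fn N L h 0 (algebraMap _ _ (Entire.exp (h⁻¹ • quadForm N L)) *
    ∏ i ∈ Finset.Icc 1 N, ∏ n ∈ Finset.Icc 1 L, dilogChi N L ε M Ψ i (2 * (n : ℤ)))

/-- The value of `σ` on `χ_i(n)`. -/
def sigmaChi (i n : ℤ) : Cq N L h :=
  let q := Complex.exp h
  let χ := chi N L h ε M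
  if Even n then χ i n
  else (q ^ 2 * (ε * M) ^ 4) • (χ i n *
    ((1 - (q⁻¹ ^ 2) • Ring.inverse (χ i (n + 1))) * Ring.inverse (1 - χ (i - 1) (n + 1))) *
    ((1 - (q⁻¹ ^ 2) • Ring.inverse (χ i (n - 1))) * Ring.inverse (1 - χ (i + 1) (n - 1))))

/-- The common value of `κ_+` on `χ_i(n - 1)` and of `κ_-` on `χ_i(n + 1)`. -/
def kappaChi (i n : ℤ) : Cq N L h :=
  let q := Complex.exp h
  let χ := chi N L h ε M
  if Even n then χ i n
  else (q⁻¹ ^ 2) • (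
    ((1 - χ (i - 1) (n + 1)) * Ring.inverse (1 - (q⁻¹ ^ 2) • Ring.inverse (χ i (n + 1)))) *
    ((1 - χ (i + 1) (n - 1)) * Ring.inverse (1 - (q⁻¹ ^ 2) • Ring.inverse (χ i (n - 1)))) *
    Ring.inverse (χ i n))

/-- `X i n t = χ_i(n, t)`, relevant for `n + t` odd, is a trajectory of the maps `κ_±`. -/
def IsTrajectory (κ : ℤˣ → Cq N L h → Cq N L h) (X : ℤ → ℤ → ℤ → Cq N L h) : Prop :=
  (∀ i n t : ℤ, Odd (n + t) → ∀ e : ℤˣ, X i (n + e) (t + 1) = κ e (X i n t)) ∧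
    (∀ i n : ℤ, Even n → X i n 1 = chi N L h ε M i n) ∧
    (∀ i n : ℤ, Odd n → X i n 0 = chi N L h ε M i n)

end Evolution

end Toda
end

/-! Functions of one parity commute, so conjugation by $U$ fixes `χ_i(n)` for $n$ even. At an odd
site $2l-1$ the exchange relation moves $e^{2\psi_i(2l-1)}$ past a function of the even variables at
the cost of a translation $T_w$. If $U$ is the function $u$, then $U^{-1}\chi U = \chi\cdot u/T_w
u$. Here $w$ is supported on four sites: it is $+h$ at $(i,l)$ and $(i,l-1)$, and $-h$ at $(i-1,l)$
and $(i+1,l-1)$.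

The quotient $u/T_w u$ has two factors. In the product of dilogarithms only these four sites move,
each by $\pm 2h$ in $\log\chi$, and the functional equation of $\Psi$ gives $1-q^2\chi$ at the two
positive sites and $(1-\chi)^{-1}$ at the two negative ones (`dilogMer_eq_translate`). For the
Gaussian factor, the kernel $s$ inverts the bracket up to terms that the central constraints kill
(`s_second_difference`, `sum_sum_kernel`), so $H$ grows by $2h(\psi_i(2l)+\psi_i(2l-2)+h)$. The
resulting monomial turns each $1-q^2\chi$ into $1-q^{-2}\chi^{-1}$ and leaves the prefactor
$q^2(\varepsilon M)^4$ (`evolMer_eq_translate`).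

The inversion of the bracket is a discrete Green function computation: the difference of
$\varepsilon_m$ is a delta function minus a constant, and averaging over $j$ turns
$\delta_J,\delta_N$ into $\delta_L,\delta_F$. The unwanted terms depend only on $k$, or only on
$i+k$ modulo $F$, or on nothing, which is what $u=v=0$ annihilates.

The product $\lambda_+\lambda_-$ is $\psi\mapsto-\psi$. Since $H$ is even and shift invariant and
the dilogarithm product runs over all sites, $\lambda_+(U)=\lambda_-(U)=V$ (`lam_evolU`). With
$\kappa_\pm=\sigma\circ\lambda_\pm$ this gives
$\kappa_d\kappa_e(x)=(VU)^{-1}\lambda_d\lambda_e(x)\,VU$ for all signs, hence commutativity and the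
evolution formula. Other endomorphisms with the same values on generators have the same two-step
images of generators, because those values are rational expressions in the generators. -/

noncomputable section

namespace Toda

/-! ### Sums over residues -/

section Residues

variable {R : Type*} [CommMonoid R]

/-- The integers `1, …, P` represent every residue modulo `P` once. -/
theorem prod_Icc_intCast (P : ℕ) [NeZero P] (f : ZMod P → R) :
    ∏ j ∈ Finset.Icc 1 P, f ((j : ℤ) : ZMod P) = ∏ a : ZMod P, f a := by
  have hP : 0 < P := Nat.pos_of_ne_zero (NeZero.ne P)
  refine Finset.prod_bij (fun j _ => ((j : ℤ) : ZMod P)) (fun _ _ => Finset.mem_univ _) ?_ ?_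
    (fun _ _ => rfl)
  · intro a ha b hb hab
    rw [Finset.mem_Icc] at ha hb
    rw [ZMod.intCast_eq_intCast_iff_dvd_sub] at hab
    obtain ⟨c, hc⟩ := hab
    have h1 : c < 1 := by
      by_contra! h
      nlinarith
    have h2 : -1 < c := by
      by_contra! h
      nlinarith
    have : c = 0 := by omega
    subst this
    omega
  · intro b _
    -- The range starts at 1, so the residue 0 is represented by `P`.
    rcases Nat.eq_zero_or_pos b.val with h | h
    · refine ⟨P, Finset.mem_Icc.mpr ⟨hP, le_rfl⟩, ?_⟩
      rw [(ZMod.val_eq_zero b).mp h]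
      simp
    · exact ⟨b.val, Finset.mem_Icc.mpr ⟨h, (ZMod.val_lt b).le⟩, by simp⟩

end Residues

/-- A periodic function on the integers factors through the residues. -/
theorem periodic_eq_residue {R : Type*} (P : ℕ) [NeZero P] {f : ℤ → R} (hf : Function.Periodic f P) (j : ℤ) :
    f j = f (((j : ZMod P).val : ℤ)) := by
  have : (((j : ZMod P).val : ℤ) : ZMod P) = (j : ZMod P) := by simp
  rw [ZMod.intCast_eq_intCast_iff_dvd_sub] at this
  obtain ⟨c, hc⟩ := this
  have := hf.int_mul c (((j : ZMod P).val : ℤ))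
  rw [← this]
  congr 1
  rw [Int.cast_id]
  linarith [mul_comm c (P : ℤ)]

theorem sum_Icc_intCast (P : ℕ) [NeZero P] (f : ZMod P → ℂ) :
    ∑ j ∈ Finset.Icc 1 P, f ((j : ℤ) : ZMod P) = ∑ a : ZMod P, f a :=
  prod_Icc_intCast (R := Multiplicative ℂ) P f

theorem sum_Icc_periodic_add (P : ℕ) [NeZero P] {f : ℤ → ℂ} (hf : Function.Periodic f P) :
    ∑ j ∈ Finset.Icc 1 P, f (j + 1) = ∑ j ∈ Finset.Icc 1 P, f j := by
  have h : ∀ j, f j = f (((j : ZMod P).val : ℤ)) :=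
    periodic_eq_residue P hf
  have h1 := sum_Icc_intCast P (fun a : ZMod P => f ((a + 1).val : ℤ))
  have h2 := sum_Icc_intCast P (fun a : ZMod P => f (a.val : ℤ))
  rw [← Equiv.sum_comp (Equiv.addRight (1 : ZMod P))] at h2
  simp only [Equiv.coe_addRight] at h2
  rw [← h1] at h2
  calc _ = ∑ j ∈ Finset.Icc 1 P, f (((((j : ℤ) : ZMod P) + 1).val : ℤ)) := by
        refine Finset.sum_congr rfl fun j _ => ?_
        rw [h (j + 1)]
        push_cast
        rfl
    _ = _ := by
        rw [← h2]
        exact Finset.sum_congr rfl fun j _ => (h j).symm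

theorem sum_Icc_periodic_neg (P : ℕ) [NeZero P] {f : ℤ → ℂ} (hf : Function.Periodic f P) :
    ∑ j ∈ Finset.Icc 1 P, f (-(j : ℤ)) = ∑ j ∈ Finset.Icc 1 P, f j := by
  have h : ∀ j, f j = f (((j : ZMod P).val : ℤ)) :=
    periodic_eq_residue P hf
  have h1 := sum_Icc_intCast P (fun a : ZMod P => f ((-a).val : ℤ))
  have h2 := sum_Icc_intCast P (fun a : ZMod P => f (a.val : ℤ))
  rw [← Equiv.sum_comp (Equiv.neg (ZMod P))] at h2
  simp only [Equiv.neg_apply] at h2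
  rw [← h1] at h2
  calc _ = ∑ j ∈ Finset.Icc 1 P, f (((-((j : ℤ) : ZMod P)).val : ℤ)) := by
        refine Finset.sum_congr rfl fun j _ => ?_
        rw [h (-j)]
        push_cast
        rfl
    _ = _ := by
        rw [← h2]
        exact Finset.sum_congr rfl fun j _ => (h j).symm

/-! ### The functions `δ_m` and `ε_m` -/

theorem delta_eq (m : ℕ) (n : ℤ) : delta m n = if (m : ℤ) ∣ n then 1 else 0 := by
  simp [delta, ← ZMod.intCast_zmod_eq_zero_iff_dvd]

theorem eps_periodic (m : ℕ) : Function.Periodic (eps m) m := fun n => by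
  simp [eps]

theorem eps_add_of_dvd {m : ℕ} {c : ℤ} (hc : (m : ℤ) ∣ c) (n : ℤ) : eps m (n + c) = eps m n := by
  obtain ⟨d, rfl⟩ := hc
  rw [mul_comm]
  exact (eps_periodic m).int_mul d n

/-- `ε_m(-1 - n) = -ε_m(n)`. -/
theorem eps_reflect {m : ℕ} (hm : 0 < m) (n : ℤ) : eps m (-1 - n) = -eps m n := by
  have h : (-1 - n) % (m : ℤ) = m - 1 - n % m := by
    have h0 := Int.emod_nonneg n (b := (m : ℤ)) (by omega)
    have h1 := Int.emod_lt_of_pos n (b := (m : ℤ)) (by omega)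
    have h2 := Int.emod_add_mul_ediv n m
    rw [show -1 - n = (m - 1 - n % m) + m * (-(n / m) - 1) by linarith, Int.add_mul_emod_self_left]
    exact Int.emod_eq_of_lt (by omega) (by omega)
  rw [eps, eps, h]
  push_cast
  ring

/-- `ε_m(n) - ε_m(n - 1) = 2 δ_m(n) - 2 / m`. -/
theorem eps_sub {m : ℕ} (hm : 0 < m) (n : ℤ) :
    eps m n - eps m (n - 1) = 2 * delta m n - 2 / m := by
  have hm' : (m : ℂ) ≠ 0 := by exact_mod_cast hm.ne'
  have h0 := Int.emod_nonneg n (b := (m : ℤ)) (by omega)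
  have h1 := Int.emod_lt_of_pos n (b := (m : ℤ)) (by omega)
  have h2 := Int.emod_add_mul_ediv n m
  rw [delta_eq, eps, eps]
  split_ifs with hd
  · have hn : n % m = 0 := Int.emod_eq_zero_of_dvd hd
    have h : (n - 1) % (m : ℤ) = m - 1 := by
      rw [show n - 1 = (m - 1) + m * (n / m - 1) by linarith, Int.add_mul_emod_self_left]
      exact Int.emod_eq_of_lt (by omega) (by omega)
    rw [h, hn]
    push_cast
    field_simp
    ring
  · have hn : n % m ≠ 0 := fun h => hd (Int.dvd_of_emod_eq_zero h)
    have h : (n - 1) % (m : ℤ) = n % m - 1 := by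
      rw [show n - 1 = (n % m - 1) + m * (n / m) by linarith, Int.add_mul_emod_self_left]
      exact Int.emod_eq_of_lt (by omega) (by omega)
    rw [h]
    push_cast
    field_simp
    ring

/-- Multiplication by a unit permutes the residues, so exactly one `j` hits zero. -/
theorem sum_delta_affine (P : ℕ) [NeZero P] (x : ℤ) {c : ℤ} (hc : IsUnit (c : ZMod P)) :
    ∑ j ∈ Finset.Icc 1 P, delta P (x + (j : ℤ) * c) = 1 := by
  obtain ⟨u, hu⟩ := hc
  have := sum_Icc_intCast P (fun a : ZMod P => if (x : ZMod P) + a * c = 0 then (1 : ℂ) else 0)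
  simp only [delta, Int.cast_add, Int.cast_mul]
  rw [this, ← hu]
  have h : ∀ a : ZMod P, (x : ZMod P) + a * u = 0 ↔ a = -x * ↑u⁻¹ := fun a => by
    rw [Units.eq_mul_inv_iff_mul_eq, add_comm, add_eq_zero_iff_eq_neg]
  simp [h]

theorem delta_mul_left {F : ℕ} (hF : 0 < F) (m : ℕ) (x : ℤ) :
    delta (F * m) (F * x) = delta m x := by
  simp only [delta_eq, Nat.cast_mul, Int.mul_dvd_mul_iff_left (show (F : ℤ) ≠ 0 by omega)]

/-! ### The Green function `green` and the kernel `s` -/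

section Kernel

variable (N L : ℕ)

theorem gcd_mul_div : Nat.gcd L N * (N / Nat.gcd L N) = N :=
  Nat.mul_div_cancel' (Nat.gcd_dvd_right L N)

theorem mul_div_eq_lcm : L * (N / Nat.gcd L N) = Nat.lcm L N := by
  rw [Nat.lcm, Nat.mul_div_assoc _ (Nat.gcd_dvd_right L N)]

/-- The function `(x, y) ↦ ½ ∑ ε_J(x + j L) ε_N(y + j L)`. -/
def green (x y : ℤ) : ℂ :=
  1 / 2 * ∑ j ∈ Finset.Icc 1 (N / Nat.gcd L N),
    eps (Nat.lcm L N) (x + (j : ℤ) * L) * eps N (y + (j : ℤ) * L)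

/-- The arguments of `g` have odd sum, so both halves are exact and the floor divisions disappear.
-/
theorem s_eq_green (i n : ℤ) :
    s N L i n = green N L (n - 1) (i + n - 1) + green N L n (i + n) := by
  simp only [s, g, green]
  rw [show (i + 2 * n - 1 - i - 1) / 2 = n - 1 by omega,
    show (i + 2 * n - 1 + i - 1) / 2 = i + n - 1 by omega,
    show (i + 2 * n + 1 - i - 1) / 2 = n by omega,
    show (i + 2 * n + 1 + i - 1) / 2 = i + n by omega]

/-- Raising `j` by $N/F$ moves both arguments by $L\cdot N/F=J$, a common multiple of the periods
$J$ and $N$. -/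
theorem green_summand_periodic (x y : ℤ) : Function.Periodic (fun j : ℤ =>
    eps (Nat.lcm L N) (x + j * L) * eps N (y + j * L)) (N / Nat.gcd L N : ℕ) := by
  intro j
  have h : (((N / Nat.gcd L N : ℕ) : ℤ)) * L = (Nat.lcm L N : ℕ) := by
    rw [← mul_div_eq_lcm]
    push_cast
    ring
  have h1 : (N : ℤ) ∣ (Nat.lcm L N : ℕ) := Int.natCast_dvd_natCast.mpr (Nat.dvd_lcm_right L N)
  simp only [add_mul, h, ← add_assoc]
  rw [eps_add_of_dvd (dvd_refl _), eps_add_of_dvd h1]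

theorem s_periodic_left (n : ℤ) : Function.Periodic (fun i => s N L i n) N := fun i => by
  simp only [s_eq_green, green]
  congr 2 <;> refine Finset.sum_congr rfl fun j _ => ?_ <;> congr 1
  · rw [← eps_periodic N (i + n - 1 + j * L)]
    congr 1
    ring
  · rw [← eps_periodic N (i + n + j * L)]
    congr 1
    ring

theorem gcd_pos_of_neZero [NeZero N] : 0 < Nat.gcd L N :=
  Nat.gcd_pos_of_pos_right _ (Nat.pos_of_ne_zero (NeZero.ne N))

variable [NeZero N]

theorem div_gcd_ne_zero : NeZero (N / Nat.gcd L N) :=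
  ⟨fun h => by
    have := gcd_mul_div N L
    rw [h, mul_zero] at this
    exact NeZero.ne N this.symm⟩

/-- As $L/F$ is a unit modulo $N/F$, the numbers $jL$ run once through the multiples of $F$ modulo
$N$. -/
theorem sum_delta_gcd (y : ℤ) :
    ∑ j ∈ Finset.Icc 1 (N / Nat.gcd L N), delta N (y + (j : ℤ) * L) = delta (Nat.gcd L N) y := by
  have := div_gcd_ne_zero N L
  have hF := gcd_pos_of_neZero N L
  have hL : ((Nat.gcd L N : ℕ) : ℤ) * ((L / Nat.gcd L N : ℕ) : ℤ) = L := by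
    exact_mod_cast Nat.mul_div_cancel' (Nat.gcd_dvd_left L N)
  by_cases hy : ((Nat.gcd L N : ℕ) : ℤ) ∣ y
  · obtain ⟨z, rfl⟩ := hy
    have hu : IsUnit (((L / Nat.gcd L N : ℕ) : ℤ) : ZMod (N / Nat.gcd L N)) := by
      rw [Int.cast_natCast, ZMod.isUnit_iff_coprime]
      exact Nat.coprime_div_gcd_div_gcd hF
    rw [delta_eq (Nat.gcd L N), if_pos (dvd_mul_right _ _),
      ← sum_delta_affine (N / Nat.gcd L N) z hu]
    refine Finset.sum_congr rfl fun j _ => ?_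
    rw [← delta_mul_left hF _ (z + (j : ℤ) * _), gcd_mul_div]
    congr 1
    rw [← hL]
    generalize ((L / Nat.gcd L N : ℕ) : ℤ) = c
    generalize ((Nat.gcd L N : ℕ) : ℤ) = d
    ring
  · rw [delta_eq (Nat.gcd L N), if_neg hy]
    refine Finset.sum_eq_zero fun j _ => ?_
    rw [delta_eq, if_neg]
    intro h
    apply hy
    have h1 : ((Nat.gcd L N : ℕ) : ℤ) ∣ y + j * L :=
      (Int.natCast_dvd_natCast.mpr (Nat.gcd_dvd_right L N)).trans h
    refine (dvd_add_left (Dvd.dvd.mul_left ?_ _)).mp h1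
    exact Int.natCast_dvd_natCast.mpr (Nat.gcd_dvd_left L N)

/-- Adding $L$ to both arguments is $j\mapsto j+1$ in a periodic sum. This averaging is what makes
`s` periodic modulo $L$ in its second argument, although $\varepsilon_N$ is not. -/
theorem green_add (x y : ℤ) : green N L (x + L) (y + L) = green N L x y := by
  have := div_gcd_ne_zero N L
  have := sum_Icc_periodic_add _ (green_summand_periodic N L x y)
  rw [green, green, ← this]
  congr 1
  refine Finset.sum_congr rfl fun j _ => ?_
  congr 2 <;> ring

theorem s_periodic_right (i : ℤ) : Function.Periodic (s N L i) L := fun n => by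
  rw [s_eq_green, s_eq_green, ← green_add N L (n - 1), ← green_add N L n]
  congr 2 <;> ring

variable [NeZero L]

/-- Since $J=L\cdot N/F$, for $x=Ly$ the condition $J\mid x+jL$ is $y+j\equiv0$ modulo $N/F$, which
has one solution. -/
theorem sum_delta_lcm (x : ℤ) :
    ∑ j ∈ Finset.Icc 1 (N / Nat.gcd L N), delta (Nat.lcm L N) (x + (j : ℤ) * L) = delta L x := by
  have := div_gcd_ne_zero N L
  by_cases hx : (L : ℤ) ∣ x
  · obtain ⟨y, rfl⟩ := hx
    rw [delta_eq L, if_pos (dvd_mul_right _ _), ← sum_delta_affine (N / Nat.gcd L N) y (c := 1)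
      (by simp)]
    refine Finset.sum_congr rfl fun j _ => ?_
    rw [← mul_div_eq_lcm,
      ← delta_mul_left (Nat.pos_of_ne_zero (NeZero.ne L)) _ (y + (j : ℤ) * 1)]
    congr 1
    ring
  · rw [delta_eq L, if_neg hx]
    refine Finset.sum_eq_zero fun j _ => ?_
    rw [delta_eq, if_neg]
    intro h
    apply hx
    have h1 : (L : ℤ) ∣ x + j * L := (Int.natCast_dvd_natCast.mpr (Nat.dvd_lcm_left L N)).trans h
    exact (dvd_add_left (Dvd.intro_left _ rfl)).mp h1

theorem lcm_pos_of_neZero : 0 < Nat.lcm L N :=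
  Nat.lcm_pos (Nat.pos_of_ne_zero (NeZero.ne L)) (Nat.pos_of_ne_zero (NeZero.ne N))

/-- Both $\varepsilon$ factors change sign under $n\mapsto-1-n$; the signs cancel, and $j\mapsto-j$
preserves the periodic sum. -/
theorem green_reflect (x y : ℤ) : green N L (-1 - x) (-1 - y) = green N L x y := by
  have := div_gcd_ne_zero N L
  have := sum_Icc_periodic_neg _ (green_summand_periodic N L x y)
  rw [green, green, ← this]
  congr 1
  refine Finset.sum_congr rfl fun j _ => ?_
  rw [show -1 - x + (j : ℤ) * L = -1 - (x + -(j : ℤ) * L) by ring,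
    show -1 - y + (j : ℤ) * L = -1 - (y + -(j : ℤ) * L) by ring, eps_reflect (lcm_pos_of_neZero N L),
    eps_reflect (Nat.pos_of_ne_zero (NeZero.ne N)), neg_mul_neg]

/-- The reflection of `green` exchanges the two terms of `s`. This makes the quadratic form
symmetric. -/
theorem s_neg (i n : ℤ) : s N L (-i) (-n) = s N L i n := by
  rw [s_eq_green, s_eq_green, ← green_reflect N L (-n - 1), ← green_reflect N L (-n), add_comm]
  congr 2 <;> ring

theorem s_congr {i i' n n' : ℤ} (hi : (i : ZMod N) = (i' : ZMod N))
    (hn : (n : ZMod L) = (n' : ZMod L)) : s N L i n = s N L i' n' := by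
  have h1 := periodic_eq_residue N (s_periodic_left N L n)
  have h2 := periodic_eq_residue L (s_periodic_right N L i')
  calc s N L i n = s N L ((i : ZMod N).val : ℤ) n := h1 i
    _ = s N L i' n := by rw [hi]; exact (h1 i').symm
    _ = s N L i' ((n : ZMod L).val : ℤ) := h2 n
    _ = s N L i' n' := by rw [hn]; exact (h2 n').symm

/-- The mixed second difference of `green`. -/
theorem green_mixed_difference (x y : ℤ) :
    green N L x y - green N L x (y - 1) - green N L (x - 1) y + green N L (x - 1) (y - 1) =
      2 * (delta L x * delta N (y - x)) - 2 / N * delta L x -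
        2 / (Nat.lcm L N : ℕ) * delta (Nat.gcd L N) y +
          2 / ((Nat.lcm L N : ℕ) * N) * ((N / Nat.gcd L N : ℕ) : ℂ) := by
  have hN : 0 < N := Nat.pos_of_ne_zero (NeZero.ne N)
  -- Since $N\mid J$, the first delta forces $jL\equiv-x$ modulo $N$, so the second no longer
  -- depends on `j`.
  have e1 : ∀ j : ℤ, delta (Nat.lcm L N) (x + j * L) * delta N (y + j * L) =
      delta (Nat.lcm L N) (x + j * L) * delta N (y - x) := by
    intro j
    rw [delta_eq (Nat.lcm L N)]
    split_ifs with hd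
    · congr 1
      have h1 : (N : ℤ) ∣ x + j * L :=
        (Int.natCast_dvd_natCast.mpr (Nat.dvd_lcm_right L N)).trans hd
      apply delta_congr
      rw [ZMod.intCast_eq_intCast_iff_dvd_sub]
      rw [show y - x - (y + j * L) = -(x + j * L) by ring]
      exact h1.neg_right
    · simp
  -- The left side factors as a difference of $\varepsilon_J$ times a difference of $\varepsilon_N$,
  -- that is $(2\delta_J-2/J)(2\delta_N-2/N)$.
  have e2 : ∀ j : ℤ, eps (Nat.lcm L N) (x + j * L) * eps N (y + j * L) -
      eps (Nat.lcm L N) (x + j * L) * eps N (y - 1 + j * L) -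
      eps (Nat.lcm L N) (x - 1 + j * L) * eps N (y + j * L) +
      eps (Nat.lcm L N) (x - 1 + j * L) * eps N (y - 1 + j * L) =
      4 * delta N (y - x) * delta (Nat.lcm L N) (x + j * L) -
        4 / N * delta (Nat.lcm L N) (x + j * L) -
        4 / (Nat.lcm L N : ℕ) * delta N (y + j * L) + 4 / ((Nat.lcm L N : ℕ) * N) := by
    intro j
    have a1 := eps_sub (lcm_pos_of_neZero N L) (x + j * L)
    have a2 := eps_sub hN (y + j * L)
    rw [show x - 1 + j * L = x + j * L - 1 by ring, show y - 1 + j * L = y + j * L - 1 by ring]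
    have : (4 : ℂ) / ((Nat.lcm L N : ℕ) * N) = 2 / (Nat.lcm L N : ℕ) * (2 / N) := by
      rw [div_mul_div_comm]; norm_num
    rw [this]
    linear_combination (2 * delta N (y + j * L) - 2 / N) * a1 +
      (eps (Nat.lcm L N) (x + j * L) - eps (Nat.lcm L N) (x + j * L - 1)) * a2 + 4 * e1 j
  simp only [green]
  rw [← mul_sub, ← mul_sub, ← mul_add, ← Finset.sum_sub_distrib, ← Finset.sum_sub_distrib,
    ← Finset.sum_add_distrib, Finset.sum_congr rfl fun (j : ℕ) _ => e2 j]
  simp only [Finset.sum_add_distrib, Finset.sum_sub_distrib, ← Finset.mul_sum, sum_delta_lcm,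
    sum_delta_gcd, Finset.sum_const, Nat.card_Icc, Nat.add_sub_cancel, nsmul_eq_mul]
  ring

/-- Up to central terms, `s` inverts the bracket. -/
theorem s_second_difference (i n : ℤ) :
    s N L i n - s N L (i + 1) n + s N L i (n + 1) - s N L (i - 1) (n + 1) =
      2 * (delta L n + delta L (n + 1)) * delta N i - 2 / N * (delta L n + delta L (n + 1)) -
        2 / (Nat.lcm L N : ℕ) * (delta (Nat.gcd L N) (i + n) + delta (Nat.gcd L N) (i + n + 1)) +
          4 / ((Nat.lcm L N : ℕ) * N) * ((N / Nat.gcd L N : ℕ) : ℂ) := by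
  -- The eight values of `green` regroup into the mixed differences at $(n,i+n)$ and $(n+1,i+n+1)$.
  have h1 := green_mixed_difference N L n (i + n)
  have h2 := green_mixed_difference N L (n + 1) (i + n + 1)
  rw [add_sub_cancel_right] at h1
  rw [show i + n + 1 - (n + 1) = i by ring, add_sub_cancel_right, add_sub_cancel_right] at h2
  simp only [s_eq_green]
  rw [show i + (n + 1) - 1 = i + n by ring, show i + (n + 1) = i + n + 1 by ring,
    show i + 1 + n - 1 = i + n by ring, show i + 1 + n = i + n + 1 by ring,
    show i - 1 + (n + 1) - 1 = i + n - 1 by ring, show i - 1 + (n + 1) = i + n by ring,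
    add_sub_cancel_right]
  linear_combination h1 + h2

end Kernel

end Toda

/-! ### Translations of entire and meromorphic functions -/

namespace Entire

variable {V : Type} [NormedAddCommGroup V] [NormedSpace ℂ V]

@[ext]
theorem ext {f g : Entire V} (hfg : ∀ x, f.1 x = g.1 x) : f = g :=
  Subtype.ext (funext hfg)

/-- Translation by `w`, as an automorphism of the algebra of entire functions. -/
def translateEquiv (w : V) : Entire V ≃ₐ[ℂ] Entire V where
  toFun := translate w
  invFun := translate (-w)
  left_inv f := by ext x; simp [translate]
  right_inv f := by ext x; simp [translate]
  map_mul' _ _ := rfl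
  map_add' _ _ := rfl
  commutes' _ := rfl

theorem exp_add (f g : Entire V) : exp (f + g) = exp f * exp g := by
  ext x
  exact Complex.exp_add _ _

theorem exp_ne_zero (f : Entire V) : exp f ≠ 0 := fun h0 =>
  Complex.exp_ne_zero (f.1 0) (congrFun (congrArg Subtype.val h0) 0)

end Entire

namespace Mer

variable {V : Type} [NormedAddCommGroup V] [NormedSpace ℂ V]

theorem algebraMap_ne_zero {f : Entire V} (hf : f ≠ 0) : algebraMap (Entire V) (Mer V) f ≠ 0 :=
  (map_ne_zero_iff _ (IsFractionRing.injective (Entire V) (Mer V))).mpr hf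

/-- Translation by `w`, as an automorphism of the field of meromorphic functions. -/
def translate (w : V) : Mer V ≃ₐ[ℂ] Mer V :=
  IsFractionRing.algEquivOfAlgEquiv (Entire.translateEquiv w)

theorem translate_algebraMap (w : V) (f : Entire V) :
    translate w (algebraMap _ _ f) = algebraMap _ _ (Entire.translate w f) :=
  IsFractionRing.algEquivOfAlgEquiv_algebraMap _ _

end Mer

namespace Toda

/-! ### Coordinates on the constrained space -/

section Coordinates

variable {N L : ℕ} [NeZero N] [NeZero L]

/-- The coordinate `x ↦ x a` on the phase space. -/
def coord (a : ZMod N × ZMod L) : Entire (Phase N L) := ⟨fun x => x.1 a, fun x _ =>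
    (((ContinuousLinearMap.proj a :
      (ZMod N × ZMod L → ℂ) →L[ℂ] ℂ).comp (Phase N L).subtypeL).analyticAt x)⟩

theorem psiFun_eq_coord (i n : ℤ) :
    psiFun N L i n = coord ((i : ZMod N), (half n : ZMod L)) := rfl

theorem half_two_mul (k : ℤ) : half (2 * k) = k := by
  simp only [half]; omega

/-- The shift of the coordinates of even sites under conjugation by `exp(2 ψ_i(2 l - 1))`. -/
theorem two_smul_bracketVec_apply (h : ℂ) (i l : ℤ) (a : ZMod N × ZMod L) :
    ((2 : ℂ) • bracketVec N L h i (2 * l - 1)).1 a =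
      h * ((if a = ((i : ZMod N), (l : ZMod L)) then 1 else 0) -
        (if a = (((i - 1 : ℤ) : ZMod N), (l : ZMod L)) then 1 else 0) +
        (if a = ((i : ZMod N), ((l - 1 : ℤ) : ZMod L)) then 1 else 0) -
        (if a = (((i + 1 : ℤ) : ZMod N), ((l - 1 : ℤ) : ZMod L)) then 1 else 0)) := by
  have ho : Odd (2 * l - 1) := ⟨l - 1, by ring⟩
  have hp : (((2 * l - 1 : ℤ) : ZMod 2) + 1).val = 0 := by
    rw [(ZMod.intCast_eq_one_iff_odd).mpr ho]; rfl
  have e : ((2 : ℂ) • bracketVec N L h i (2 * l - 1)).1 a = 2 * bracket N L h a.1.val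
      (2 * (a.2.val : ℤ) - (((((2 * l - 1 : ℤ) : ZMod 2) + 1).val : ℕ) : ℤ)) i (2 * l - 1) := rfl
  rw [e, hp, Nat.cast_zero, sub_zero, bracket_odd _ _ _ _ _ _ _ ho,
    show (2 * l - 1 + 1) / 2 = l by omega, Omega]
  rw [show (a.1.val : ℤ) - i + 1 = a.1.val - (i - 1) by ring,
    show (a.1.val : ℤ) - i - 1 = a.1.val - (i + 1) by ring,
    show (a.2.val : ℤ) - l + 1 = a.2.val - (l - 1) by ring]
  simp only [delta_val_sub, Prod.ext_iff, ite_and]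
  split_ifs <;> ring

theorem ne_sub_one {R : Type*} [Ring R] [Nontrivial R] (a : R) : a ≠ a - 1 :=
  fun ha => one_ne_zero (sub_eq_self.mp ha.symm)

/-- The constraints do not make any coordinate vanish: the bracket vectors lie in `Phase N L`, and
for $h=1$ the one below has entry 1 at `a`, because its other three sites differ from `a` when
$N,L\ge2$. -/
theorem exists_coord_eq_one (hN : 2 ≤ N) (hL : 2 ≤ L) (a : ZMod N × ZMod L) :
    ∃ x : Phase N L, x.1 a = 1 := by
  have hN1 : Fact (1 < N) := ⟨hN⟩
  have hL1 : Fact (1 < L) := ⟨hL⟩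
  refine ⟨(2 : ℂ) • bracketVec N L 1 (a.1.val : ℤ) (2 * (a.2.val : ℤ) - 1), ?_⟩
  rw [two_smul_bracketVec_apply]
  simp [Prod.ext_iff, ne_sub_one]

theorem exists_coord_eq (hN : 2 ≤ N) (hL : 2 ≤ L) (a : ZMod N × ZMod L) (c : ℂ) :
    ∃ x : Phase N L, x.1 a = c := by
  obtain ⟨x, hx⟩ := exists_coord_eq_one hN hL a
  exact ⟨c • x, by simp [hx]⟩

/-! ### The quadratic form -/

/-- The coefficients of the quadratic form. -/
def kernel (a b : ZMod N × ZMod L) : ℂ :=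
  s N L ((a.1.val : ℤ) - b.1.val) ((a.2.val : ℤ) - b.2.val)

theorem kernel_intCast (a : ZMod N × ZMod L) (j k : ℤ) :
    kernel a ((j : ZMod N), (k : ZMod L)) = s N L ((a.1.val : ℤ) - j) ((a.2.val : ℤ) - k) :=
  s_congr N L (by simp) (by simp)

theorem kernel_comm (a b : ZMod N × ZMod L) : kernel a b = kernel b a := by
  rw [kernel, ← s_neg, kernel, neg_sub, neg_sub]

theorem kernel_add_right (a b : ZMod N × ZMod L) (c : ZMod L) :
    kernel (a.1, a.2 + c) (b.1, b.2 + c) = kernel a b :=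
  s_congr N L (by simp) (by simp)

theorem sum_kernel_mul (h : ℂ) (i l : ℤ) (a : ZMod N × ZMod L) :
    ∑ b, kernel a b * ((2 : ℂ) • bracketVec N L h i (2 * l - 1)).1 b =
      h * (kernel a ((i : ZMod N), (l : ZMod L)) -
        kernel a (((i - 1 : ℤ) : ZMod N), (l : ZMod L)) +
        kernel a ((i : ZMod N), ((l - 1 : ℤ) : ZMod L)) -
        kernel a (((i + 1 : ℤ) : ZMod N), ((l - 1 : ℤ) : ZMod L))) := by
  simp only [two_smul_bracketVec_apply, mul_add, mul_sub, Finset.sum_add_distrib,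
    Finset.sum_sub_distrib, mul_ite, mul_one, mul_zero, Finset.sum_ite_eq',
    Finset.mem_univ, if_true]
  ring

theorem sum_phase_delta_right (x : Phase N L) (b : ℤ) :
    ∑ a : ZMod N × ZMod L, x.1 a * delta L ((a.2.val : ℤ) - b) = 0 := by
  rw [Fintype.sum_prod_type_right]
  refine Finset.sum_eq_zero fun k _ => ?_
  have := congrArg (· * delta L ((k.val : ℤ) - b)) (x.2.1 k)
  simpa [Finset.sum_mul] using this

theorem sum_phase (x : Phase N L) : ∑ a : ZMod N × ZMod L, x.1 a = 0 := by
  rw [Fintype.sum_prod_type_right]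
  exact Finset.sum_eq_zero fun k _ => x.2.1 k

theorem sum_phase_delta_gcd (x : Phase N L) (r : ℤ) :
    ∑ a : ZMod N × ZMod L, x.1 a *
      delta (Nat.gcd L N) ((a.1.val : ℤ) + (a.2.val : ℤ) - r) = 0 := by
  rw [Fintype.sum_prod_type]
  exact x.2.2 r

theorem sum_delta_delta (x : ZMod N × ZMod L → ℂ) (i l : ℤ) :
    ∑ a, x a * (delta L ((a.2.val : ℤ) - l) * delta N ((a.1.val : ℤ) - i)) =
      x ((i : ZMod N), (l : ZMod L)) := by
  rw [Finset.sum_eq_single ((i : ZMod N), (l : ZMod L))]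
  · rw [delta_val_sub, delta_val_sub]
    simp
  · intro a _ ha
    simp only [delta_val_sub]
    split_ifs with h1 h2
    · exact absurd (Prod.ext h2 h1) ha
    all_goals simp
  · simp

/-- On the constrained phase space the kernel inverts the bracket. -/
theorem sum_sum_kernel (h : ℂ) (i l : ℤ) (x : Phase N L) :
    ∑ a, x.1 a * ∑ b, kernel a b * ((2 : ℂ) • bracketVec N L h i (2 * l - 1)).1 b =
      2 * h * (x.1 ((i : ZMod N), (l : ZMod L)) + x.1 ((i : ZMod N), ((l - 1 : ℤ) : ZMod L))) := by
  -- The two terms with $\delta_L\delta_N$ survive. The terms with $\delta_L$ alone and the constant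
  -- term vanish because every row sum $\sum_i x(i,k)$ does, and the terms with $\delta_F$ vanish by
  -- the constraint $v=0$.
  have e : ∀ a : ZMod N × ZMod L,
      x.1 a * ∑ b, kernel a b * ((2 : ℂ) • bracketVec N L h i (2 * l - 1)).1 b =
      2 * h * (x.1 a * (delta L ((a.2.val : ℤ) - l) * delta N ((a.1.val : ℤ) - i))) +
      2 * h * (x.1 a * (delta L ((a.2.val : ℤ) - (l - 1)) * delta N ((a.1.val : ℤ) - i))) -
      h * (2 / N) * (x.1 a * delta L ((a.2.val : ℤ) - l)) -
      h * (2 / N) * (x.1 a * delta L ((a.2.val : ℤ) - (l - 1))) -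
      h * (2 / (Nat.lcm L N : ℕ)) *
        (x.1 a * delta (Nat.gcd L N) ((a.1.val : ℤ) + (a.2.val : ℤ) - (i + l))) -
      h * (2 / (Nat.lcm L N : ℕ)) *
        (x.1 a * delta (Nat.gcd L N) ((a.1.val : ℤ) + (a.2.val : ℤ) - (i + l - 1))) +
      h * (4 / ((Nat.lcm L N : ℕ) * N) * ((N / Nat.gcd L N : ℕ) : ℂ)) * x.1 a := by
    intro a
    have hs := s_second_difference N L ((a.1.val : ℤ) - i) ((a.2.val : ℤ) - l)
    rw [sum_kernel_mul, kernel_intCast, kernel_intCast, kernel_intCast, kernel_intCast]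
    rw [show (a.1.val : ℤ) - (i - 1) = a.1.val - i + 1 by ring,
      show (a.1.val : ℤ) - (i + 1) = a.1.val - i - 1 by ring,
      show (a.2.val : ℤ) - (l - 1) = a.2.val - l + 1 by ring, hs,
      show (a.1.val : ℤ) + a.2.val - (i + l) = a.1.val - i + (a.2.val - l) by ring,
      show (a.1.val : ℤ) + a.2.val - (i + l - 1) = a.1.val - i + (a.2.val - l) + 1 by ring]
    ring
  simp only [e, Finset.sum_add_distrib, Finset.sum_sub_distrib, ← Finset.mul_sum, sum_phase,
    sum_phase_delta_right, sum_phase_delta_gcd, sum_delta_delta]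
  ring

theorem prod_Icc_prod_Icc {R : Type*} [CommMonoid R] (f : ZMod N × ZMod L → R) :
    ∏ i ∈ Finset.Icc 1 N, ∏ n ∈ Finset.Icc 1 L, f (((i : ℤ) : ZMod N), ((n : ℤ) : ZMod L)) =
      ∏ a, f a := by
  rw [Fintype.prod_prod_type, ← prod_Icc_intCast]
  exact Finset.prod_congr rfl fun i _ => prod_Icc_intCast L fun k => f (((i : ℤ) : ZMod N), k)

theorem sum_Icc_sum_Icc (f : ZMod N × ZMod L → ℂ) :
    ∑ i ∈ Finset.Icc 1 N, ∑ n ∈ Finset.Icc 1 L, f (((i : ℤ) : ZMod N), ((n : ℤ) : ZMod L)) =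
      ∑ a, f a :=
  prod_Icc_prod_Icc (R := Multiplicative ℂ) f

theorem quadForm_apply (x : Phase N L) :
    (quadForm N L).1 x = 1 / 2 * ∑ a, ∑ b, kernel a b * (x.1 a * x.1 b) := by
  have e : (quadForm N L).1 x = 1 / 2 * ∑ i ∈ Finset.Icc 1 N, ∑ j ∈ Finset.Icc 1 N,
      ∑ m ∈ Finset.Icc 1 L, ∑ n ∈ Finset.Icc 1 L, s N L ((i : ℤ) - j) ((m : ℤ) - n) *
        (x.1 (((i : ℤ) : ZMod N), ((m : ℤ) : ZMod L)) *
          x.1 (((j : ℤ) : ZMod N), ((n : ℤ) : ZMod L))) := by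
    simp only [quadForm, psiFun_eq_coord, half_two_mul]
    simp [coord, Finset.sum_apply]
  rw [e, ← sum_Icc_sum_Icc]
  congr 1
  refine Finset.sum_congr rfl fun i _ => ?_
  rw [Finset.sum_comm]
  refine Finset.sum_congr rfl fun m _ => ?_
  rw [← sum_Icc_sum_Icc]
  refine Finset.sum_congr rfl fun j _ => Finset.sum_congr rfl fun n _ => ?_
  congr 1
  exact s_congr N L (by simp) (by simp)

/-- Polarization: the two cross terms agree because the kernel is symmetric, which cancels the
factor $1/2$. -/
theorem quadForm_add (x w : Phase N L) :
    (quadForm N L).1 (x + w) = (quadForm N L).1 x + ∑ a, x.1 a * ∑ b, kernel a b * w.1 b +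
      1 / 2 * ∑ a, w.1 a * ∑ b, kernel a b * w.1 b := by
  have hc : ∑ a, ∑ b, kernel a b * (w.1 a * x.1 b) = ∑ a, ∑ b, kernel a b * (x.1 a * w.1 b) := by
    rw [Finset.sum_comm]
    refine Finset.sum_congr rfl fun a _ => Finset.sum_congr rfl fun b _ => ?_
    rw [kernel_comm]
    ring
  have e : ∀ a b, kernel a b * ((x + w).1 a * (x + w).1 b) = kernel a b * (x.1 a * x.1 b) +
      kernel a b * (x.1 a * w.1 b) + kernel a b * (w.1 a * x.1 b) +
        kernel a b * (w.1 a * w.1 b) := by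
    intro a b
    rw [Submodule.coe_add, Pi.add_apply, Pi.add_apply]
    ring
  have e' : ∀ (y : Phase N L) (a : ZMod N × ZMod L), y.1 a * ∑ b, kernel a b * w.1 b =
      ∑ b, kernel a b * (y.1 a * w.1 b) := by
    intro y a
    rw [Finset.mul_sum]
    exact Finset.sum_congr rfl fun b _ => by ring
  simp only [quadForm_apply, e, Finset.sum_add_distrib, hc, e']
  ring

/-- The translate of the quadratic form by `[ψ, 2 ψ_i(2 l - 1)]`. -/
theorem translate_quadForm (hN : 2 ≤ N) (hL : 2 ≤ L) (h : ℂ) (i l : ℤ) :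
    Entire.translate ((2 : ℂ) • bracketVec N L h i (2 * l - 1)) (quadForm N L) =
      quadForm N L + (2 * h) • (coord ((i : ZMod N), (l : ZMod L)) +
        coord ((i : ZMod N), ((l - 1 : ℤ) : ZMod L)) + algebraMap ℂ _ h) := by
  have hN1 : Fact (1 < N) := ⟨hN⟩
  have hL1 : Fact (1 < L) := ⟨hL⟩
  ext x
  have e : (quadForm N L + (2 * h) • (coord ((i : ZMod N), (l : ZMod L)) +
        coord ((i : ZMod N), ((l - 1 : ℤ) : ZMod L)) + algebraMap ℂ _ h)).1 x =
      (quadForm N L).1 x + 2 * h * (x.1 ((i : ZMod N), (l : ZMod L)) +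
        x.1 ((i : ZMod N), ((l - 1 : ℤ) : ZMod L)) + h) := rfl
  rw [e]
  change (quadForm N L).1 (x + _) = _
  -- The inversion formula is used for `x` and then for the shift vector itself. The latter equals
  -- $h$ at both surviving sites, so it contributes $\frac12\cdot2h(h+h)=2h\cdot h$.
  rw [quadForm_add, sum_sum_kernel, sum_sum_kernel, two_smul_bracketVec_apply,
    two_smul_bracketVec_apply]
  simp [Prod.ext_iff, ne_sub_one]
  ring

theorem quadForm_comp_shift (c : ZMod L) (x : Phase N L) :
    (quadForm N L).1 (shiftEquiv N L c x) = (quadForm N L).1 x := by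
  have e : ∀ a, (shiftEquiv N L c x).1 a = x.1 (a.1, a.2 + c) := fun _ => rfl
  simp only [quadForm_apply, e]
  let E : ZMod N × ZMod L ≃ ZMod N × ZMod L := (Equiv.refl _).prodCongr (Equiv.addRight c)
  congr 1
  refine Fintype.sum_equiv E _ _ fun a => Fintype.sum_equiv E _ _ fun b => ?_
  change _ = kernel (a.1, a.2 + c) (b.1, b.2 + c) * _
  rw [kernel_add_right]
  rfl

theorem quadForm_neg (x : Phase N L) : (quadForm N L).1 (-x) = (quadForm N L).1 x := by
  simp [quadForm_apply]

end Coordinates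

end Toda

namespace Mer

variable {V : Type} [NormedAddCommGroup V] [NormedSpace ℂ V]

/-- Pull-back is contravariant; it suffices to compare numerators and denominators. -/
theorem pull_pull (S T : V ≃L[ℂ] V) (f : Mer V) : pull T (pull S f) = pull (T.trans S) f := by
  obtain ⟨a, b, _, rfl⟩ := IsFractionRing.div_surjective (A := Entire V) f
  simp only [map_div₀, Toda.Mer.pull_algebraMap]
  rfl

end Mer

namespace Toda

/-! ### The function of the even variables behind `U`, and its translates -/

section Dilogarithm

variable {N L : ℕ} [NeZero N] [NeZero L] {h : ℂ} (ε M : ℂ)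

/-- `log χ + s` at a site of the coordinate space. -/
def logCoord (s : ℂ) (a : ZMod N × ZMod L) : Entire (Phase N L) :=
  algebraMap ℂ _ (Complex.log (-((ε * M) ^ 2)) + s) + (2 : ℂ) • coord a

theorem logCoord_apply (s : ℂ) (a : ZMod N × ZMod L) (x : Phase N L) :
    (logCoord ε M s a).1 x = Complex.log (-((ε * M) ^ 2)) + s + 2 * x.1 a := rfl

/-- `χ` at a site of the coordinate space. -/
def chiMer (a : ZMod N × ZMod L) : Mer (Phase N L) :=
  algebraMap _ _ (Entire.exp (logCoord ε M 0 a))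

theorem chiMer_ne_zero (a : ZMod N × ZMod L) : chiMer ε M a ≠ 0 :=
  Mer.algebraMap_ne_zero (Entire.exp_ne_zero _)

theorem neg_sq_ne_zero {ε M : ℂ} (hε : ε ≠ 0) (hM : M ≠ 0) : -((ε * M) ^ 2) ≠ 0 :=
  neg_ne_zero.mpr (pow_ne_zero 2 (mul_ne_zero hε hM))

theorem exp_logCoord {ε M : ℂ} (hε : ε ≠ 0) (hM : M ≠ 0) (a : ZMod N × ZMod L) :
    Entire.exp (logCoord ε M 0 a) = (-((ε * M) ^ 2)) • Entire.exp ((2 : ℂ) • coord a) := by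
  ext x
  change Complex.exp (Complex.log (-((ε * M) ^ 2)) + 0 + 2 * x.1 a) =
    -((ε * M) ^ 2) * Complex.exp (2 * x.1 a)
  rw [add_zero, Complex.exp_add, Complex.exp_log (neg_sq_ne_zero hε hM)]

/-- A coordinate takes every complex value on the constrained space, hence so does $\log\chi+s$, and
a point with $G\ne0$ is reached. All invertibility statements below rest on this or on exponentials.
-/
theorem comp_logCoord_ne_zero (hN : 2 ≤ N) (hL : 2 ≤ L) {G : ℂ → ℂ} (hG : Differentiable ℂ G)
    (hG0 : G ≠ 0) (s : ℂ) (a : ZMod N × ZMod L) :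
    algebraMap _ (Mer (Phase N L)) (Entire.comp G hG (logCoord ε M s a)) ≠ 0 := by
  obtain ⟨y, hy⟩ := Function.ne_iff.mp hG0
  obtain ⟨x, hx⟩ := exists_coord_eq hN hL a ((y - (Complex.log (-((ε * M) ^ 2)) + s)) / 2)
  refine Mer.algebraMap_ne_zero fun h0 => hy ?_
  have h1 : G ((logCoord ε M s a).1 x) = 0 := congrFun (congrArg Subtype.val h0) x
  rw [logCoord_apply, hx] at h1
  rw [Pi.zero_apply, ← h1]
  congr 1
  ring

theorem one_sub_smul_chiMer_ne_zero (hN : 2 ≤ N) (hL : 2 ≤ L) (c : ℂ) (a : ZMod N × ZMod L) :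
    1 - c • chiMer ε M a ≠ 0 := by
  have hd : Differentiable ℂ (fun w => 1 - c * Complex.exp w) := by fun_prop
  have h0 : (fun w => 1 - c * Complex.exp w) ≠ 0 := by
    intro h
    -- The values $1-c$ and $1+c$ at $0$ and $\pi i$ add up to 2, so they are not both zero.
    have h1 := congrFun h 0
    have h2 := congrFun h (Real.pi * Complex.I)
    simp only [Complex.exp_zero, Complex.exp_pi_mul_I, Pi.zero_apply] at h1 h2
    have : (2 : ℂ) = 0 := by linear_combination h1 + h2
    norm_num at this
  have key := comp_logCoord_ne_zero ε M hN hL hd h0 0 a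
  have e : Entire.comp _ hd (logCoord ε M 0 a) = 1 - c • Entire.exp (logCoord ε M 0 a) := rfl
  rw [e, map_sub, map_one, algebraMap_smul'] at key
  exact key

theorem one_sub_chiMer_ne_zero (hN : 2 ≤ N) (hL : 2 ≤ L) (a : ZMod N × ZMod L) :
    1 - chiMer ε M a ≠ 0 := by
  simpa using one_sub_smul_chiMer_ne_zero ε M hN hL 1 a

theorem one_sub_smul_inv_chiMer_ne_zero (hN : 2 ≤ N) (hL : 2 ≤ L) {c : ℂ} (hc : c ≠ 0)
    (a : ZMod N × ZMod L) : 1 - c • (chiMer ε M a)⁻¹ ≠ 0 := by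
  intro h0
  apply one_sub_smul_chiMer_ne_zero ε M hN hL c⁻¹ a
  have h1 : c • (chiMer ε M a)⁻¹ = 1 := (sub_eq_zero.mp h0).symm
  have h2 : chiMer ε M a = c • 1 := by
    calc chiMer ε M a = c • (chiMer ε M a)⁻¹ * chiMer ε M a := by rw [h1, one_mul]
      _ = c • 1 := by rw [smul_mul_assoc, inv_mul_cancel₀ (chiMer_ne_zero ε M a)]
  rw [h2, smul_smul, inv_mul_cancel₀ hc, one_smul, sub_self]

/-- `Ψ(χ e^s)` at a site of the coordinate space. -/
def dilogMer (Ψ : DilogSolution h) (s : ℂ) (a : ZMod N × ZMod L) : Mer (Phase N L) :=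
  algebraMap _ _ (Entire.comp Ψ.num Ψ.num_entire (logCoord ε M s a)) /
    algebraMap _ _ (Entire.comp Ψ.den Ψ.den_entire (logCoord ε M s a))

theorem dilogMer_ne_zero (hN : 2 ≤ N) (hL : 2 ≤ L) (Ψ : DilogSolution h) (s : ℂ)
    (a : ZMod N × ZMod L) : dilogMer ε M Ψ s a ≠ 0 :=
  div_ne_zero (comp_logCoord_ne_zero ε M hN hL _ Ψ.num_ne_zero s a)
    (comp_logCoord_ne_zero ε M hN hL _ Ψ.den_ne_zero s a)

/-- This is the functional equation of $\Psi$ at $\log\chi+s$, proved for entire functions after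
clearing denominators. -/
theorem dilogMer_sub (hN : 2 ≤ N) (hL : 2 ≤ L) (Ψ : DilogSolution h) (s : ℂ)
    (a : ZMod N × ZMod L) : dilogMer ε M Ψ (s - 2 * h) a =
      (1 - Complex.exp s • chiMer ε M a) * dilogMer ε M Ψ s a := by
  have h1 := comp_logCoord_ne_zero ε M hN hL Ψ.den_entire Ψ.den_ne_zero s a
  have h2 := comp_logCoord_ne_zero ε M hN hL Ψ.den_entire Ψ.den_ne_zero (s - 2 * h) a
  have key : Entire.comp Ψ.num Ψ.num_entire (logCoord ε M (s - 2 * h) a) *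
      Entire.comp Ψ.den Ψ.den_entire (logCoord ε M s a) =
      (1 - Complex.exp s • Entire.exp (logCoord ε M 0 a)) *
        Entire.comp Ψ.num Ψ.num_entire (logCoord ε M s a) *
          Entire.comp Ψ.den Ψ.den_entire (logCoord ε M (s - 2 * h) a) := by
    ext x
    have := Ψ.equation ((logCoord ε M s a).1 x)
    change Ψ.num ((logCoord ε M (s - 2 * h) a).1 x) * Ψ.den ((logCoord ε M s a).1 x) =
      (1 - Complex.exp s * Complex.exp ((logCoord ε M 0 a).1 x)) *
        Ψ.num ((logCoord ε M s a).1 x) * Ψ.den ((logCoord ε M (s - 2 * h) a).1 x)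
    rw [← Complex.exp_add]
    simp only [logCoord_apply] at this ⊢
    rw [show Complex.log (-(ε * M) ^ 2) + (s - 2 * h) + 2 * x.1 a =
      Complex.log (-(ε * M) ^ 2) + s + 2 * x.1 a - 2 * h by ring, this]
    congr 4
    ring
  have key' := congrArg (algebraMap _ (Mer (Phase N L))) key
  simp only [map_mul, map_sub, map_one, algebraMap_smul'] at key'
  rw [dilogMer, dilogMer, div_eq_iff h2, mul_div_assoc', div_mul_eq_mul_div, eq_div_iff h1]
  exact key'

theorem translate_logCoord (w : Phase N L) (s : ℂ) (a : ZMod N × ZMod L) :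
    Entire.translate w (logCoord ε M s a) = logCoord ε M (s + 2 * w.1 a) a := by
  ext x
  change Complex.log (-((ε * M) ^ 2)) + s + 2 * (x.1 a + w.1 a) =
    Complex.log (-((ε * M) ^ 2)) + (s + 2 * w.1 a) + 2 * x.1 a
  ring

/-- The parameter `s` exists for this purpose: a translation changes only `s`, and the functional
equation then relates different values of `s`. -/
theorem translate_dilogMer (w : Phase N L) (Ψ : DilogSolution h) (s : ℂ)
    (a : ZMod N × ZMod L) :
    Mer.translate w (dilogMer ε M Ψ s a) = dilogMer ε M Ψ (s + 2 * w.1 a) a := by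
  rw [dilogMer, dilogMer, map_div₀, Mer.translate_algebraMap, Mer.translate_algebraMap,
    ← translate_logCoord]
  rfl

/-- The function of the even variables that defines `U`. -/
def evolMer (Ψ : DilogSolution h) : Mer (Phase N L) :=
  algebraMap _ _ (Entire.exp (h⁻¹ • quadForm N L)) * ∏ a, dilogMer ε M Ψ 0 a

theorem evolU_eq (Ψ : DilogSolution h) :
    evolU N L h ε M Ψ = fn N L h 0 (evolMer ε M Ψ) := by
  rw [evolU, evolMer, ← prod_Icc_prod_Icc]
  congr 2
  refine Finset.prod_congr rfl fun i _ => Finset.prod_congr rfl fun n _ => ?_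
  rw [dilogChi, dilogMer]
  have : logChi N L ε M (i : ℤ) (2 * (n : ℤ)) =
      logCoord ε M 0 (((i : ℤ) : ZMod N), ((n : ℤ) : ZMod L)) := by
    rw [logChi, logCoord, psiFun_eq_coord, half_two_mul, add_zero]
  rw [this]

theorem evolMer_ne_zero (hN : 2 ≤ N) (hL : 2 ≤ L) (Ψ : DilogSolution h) :
    evolMer (N := N) (L := L) ε M Ψ ≠ 0 :=
  mul_ne_zero (Mer.algebraMap_ne_zero (Entire.exp_ne_zero _))
    (Finset.prod_ne_zero_iff.mpr fun a _ => dilogMer_ne_zero ε M hN hL Ψ 0 a)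

/-- The factor by which conjugation with `U` multiplies `χ_i(2 l - 1)`. -/
def sigmaFactor (h : ℂ) (i l : ℤ) : Mer (Phase N L) :=
  (Complex.exp h ^ 2 * (ε * M) ^ 4) •
    (((1 - ((Complex.exp h)⁻¹ ^ 2) • (chiMer ε M ((i : ZMod N), (l : ZMod L)))⁻¹) *
      (1 - chiMer ε M (((i - 1 : ℤ) : ZMod N), (l : ZMod L)))⁻¹) *
    ((1 - ((Complex.exp h)⁻¹ ^ 2) • (chiMer ε M ((i : ZMod N), ((l - 1 : ℤ) : ZMod L)))⁻¹) *
      (1 - chiMer ε M (((i + 1 : ℤ) : ZMod N), ((l - 1 : ℤ) : ZMod L)))⁻¹))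

/-- Where $w=+h$ the functional equation reads $\Psi(\chi)=\Psi(q^2\chi)(1-q^2\chi)$; where $w=-h$
it reads $\Psi(\chi)=\Psi(q^{-2}\chi)(1-\chi)^{-1}$. The four sites are distinct because $N,L\ge2$.
Writing the correction as a product of conditionals lets the product over all sites collapse to four
factors. -/
theorem dilogMer_eq_translate (hN : 2 ≤ N) (hL : 2 ≤ L) (Ψ : DilogSolution h) (i l : ℤ)
    (a : ZMod N × ZMod L) :
    dilogMer ε M Ψ 0 a =
      Mer.translate ((2 : ℂ) • bracketVec N L h i (2 * l - 1)) (dilogMer ε M Ψ 0 a) *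
      ((if a = ((i : ZMod N), (l : ZMod L)) then
          1 - Complex.exp (2 * h) • chiMer ε M a else 1) *
        (if a = (((i - 1 : ℤ) : ZMod N), (l : ZMod L)) then (1 - chiMer ε M a)⁻¹ else 1) *
        ((if a = ((i : ZMod N), ((l - 1 : ℤ) : ZMod L)) then
          1 - Complex.exp (2 * h) • chiMer ε M a else 1) *
        (if a = (((i + 1 : ℤ) : ZMod N), ((l - 1 : ℤ) : ZMod L)) then
          (1 - chiMer ε M a)⁻¹ else 1))) := by
  have hN1 : Fact (1 < N) := ⟨hN⟩
  have hL1 : Fact (1 < L) := ⟨hL⟩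
  have hup : dilogMer ε M Ψ 0 a =
      dilogMer ε M Ψ (2 * h) a * (1 - Complex.exp (2 * h) • chiMer ε M a) := by
    have := dilogMer_sub ε M hN hL Ψ (2 * h) a
    rwa [sub_self, mul_comm] at this
  have hdown : dilogMer ε M Ψ 0 a =
      dilogMer ε M Ψ (-(2 * h)) a * (1 - chiMer ε M a)⁻¹ := by
    have := dilogMer_sub ε M hN hL Ψ 0 a
    rw [zero_sub, Complex.exp_zero, one_smul] at this
    rw [this, mul_comm, inv_mul_cancel_left₀ (one_sub_chiMer_ne_zero ε M hN hL a)]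
  rw [translate_dilogMer, two_smul_bracketVec_apply, zero_add]
  have n1 : ∀ (k : ZMod L), ((i : ZMod N), k) ≠ (((i - 1 : ℤ) : ZMod N), k) := by
    simp [Prod.ext_iff, ne_sub_one]
  have n2 : ∀ (j k : ZMod N), (j, (l : ZMod L)) ≠ (k, ((l - 1 : ℤ) : ZMod L)) := by
    simp [Prod.ext_iff, ne_sub_one]
  have n3 : ∀ (k : ZMod L), ((i : ZMod N), k) ≠ (((i + 1 : ℤ) : ZMod N), k) := by
    simp [Prod.ext_iff]
  by_cases h1 : a = ((i : ZMod N), (l : ZMod L))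
  · subst h1
    simp only [n1, n2, if_true, if_false, mul_one, sub_zero, add_zero]
    exact hup
  by_cases h2 : a = (((i - 1 : ℤ) : ZMod N), (l : ZMod L))
  · subst h2
    simp only [n2, h1, if_true, if_false, mul_one, one_mul, sub_zero, add_zero, zero_sub]
    rw [hdown]
    congr 2
    ring
  by_cases h3 : a = ((i : ZMod N), ((l - 1 : ℤ) : ZMod L))
  · subst h3
    simp only [n3, h1, h2, if_true, if_false, mul_one, one_mul, sub_zero, zero_add]
    exact hup
  by_cases h4 : a = (((i + 1 : ℤ) : ZMod N), ((l - 1 : ℤ) : ZMod L))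
  · subst h4
    simp only [h1, h2, h3, if_true, if_false, one_mul, sub_zero, zero_sub, add_zero]
    rw [hdown]
    congr 2
    ring
  · simp only [h1, h2, h3, h4, if_false, sub_zero, add_zero, mul_zero, mul_one]

theorem prod_dilogMer_eq_translate (hN : 2 ≤ N) (hL : 2 ≤ L) (Ψ : DilogSolution h) (i l : ℤ) :
    ∏ a, dilogMer ε M Ψ 0 a =
      Mer.translate ((2 : ℂ) • bracketVec N L h i (2 * l - 1)) (∏ a, dilogMer ε M Ψ 0 a) *
      (((1 - Complex.exp (2 * h) • chiMer ε M ((i : ZMod N), (l : ZMod L))) *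
        (1 - chiMer ε M (((i - 1 : ℤ) : ZMod N), (l : ZMod L)))⁻¹) *
      ((1 - Complex.exp (2 * h) • chiMer ε M ((i : ZMod N), ((l - 1 : ℤ) : ZMod L))) *
        (1 - chiMer ε M (((i + 1 : ℤ) : ZMod N), ((l - 1 : ℤ) : ZMod L)))⁻¹)) := by
  refine (Finset.prod_congr rfl fun a _ => dilogMer_eq_translate ε M hN hL Ψ i l a).trans ?_
  rw [map_prod]
  simp only [Finset.prod_mul_distrib, Finset.prod_ite_eq', Finset.mem_univ, if_true]

/-- The exponent $H/h$ grows by $2\psi+2\psi'+2h$, with $\psi,\psi'$ the coordinates at the two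
sites. The factor $(\varepsilon M)^4$ turns $e^{2\psi}e^{2\psi'}$ into a product of two values of
$\chi=-(\varepsilon M)^2e^{2\psi}$. -/
theorem translate_exp_quadForm {ε M : ℂ} (hN : 2 ≤ N) (hL : 2 ≤ L) (hh : h ≠ 0) (hε : ε ≠ 0)
    (hM : M ≠ 0) (i l : ℤ) :
    ((ε * M) ^ 4) • Mer.translate ((2 : ℂ) • bracketVec N L h i (2 * l - 1))
      (algebraMap _ _ (Entire.exp (h⁻¹ • quadForm N L))) =
      algebraMap _ _ (Entire.exp (h⁻¹ • quadForm N L)) * (Complex.exp (2 * h) •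
        (chiMer ε M ((i : ZMod N), (l : ZMod L)) *
          chiMer ε M ((i : ZMod N), ((l - 1 : ℤ) : ZMod L)))) := by
  have hq := translate_quadForm hN hL h i l
  rw [Mer.translate_algebraMap, chiMer, chiMer, exp_logCoord hε hM, exp_logCoord hε hM,
    ← map_mul, ← algebraMap_smul', ← algebraMap_smul', ← map_mul]
  congr 1
  ext x
  have hx := congrFun (congrArg Subtype.val hq) x
  set y := x.1 ((i : ZMod N), (l : ZMod L)) with hy
  set z := x.1 ((i : ZMod N), ((l - 1 : ℤ) : ZMod L)) with hz
  change (Entire.translate _ (quadForm N L)).1 x = (quadForm N L).1 x + 2 * h * (y + z + h) at hx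
  change (ε * M) ^ 4 * Complex.exp (h⁻¹ * (Entire.translate _ (quadForm N L)).1 x) =
    Complex.exp (h⁻¹ * (quadForm N L).1 x) * (Complex.exp (2 * h) *
      ((-((ε * M) ^ 2) * Complex.exp (2 * y)) * (-((ε * M) ^ 2) * Complex.exp (2 * z))))
  rw [hx, show h⁻¹ * ((quadForm N L).1 x + 2 * h * (y + z + h)) =
    h⁻¹ * (quadForm N L).1 x + (2 * h + (2 * y + 2 * z)) by field_simp; ring,
    Complex.exp_add, Complex.exp_add, Complex.exp_add]
  ring

/-- Here `q` stands for $e^{2h}$ and `p` for its inverse. From $1-qX=-qX(1-pX^{-1})$ and the same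
for $Y$ one extracts $q^2XY$; the Gaussian factor absorbs $qXY$, and one `q` is left. -/
theorem factor_identity {K : Type*} [Field K] {p q e X Y A B E T P : K} (hX : X ≠ 0) (hY : Y ≠ 0)
    (h1 : e * T = E * (q * (X * Y))) (hq : p * q = 1) :
    E * (P * ((1 - q * X) * A * ((1 - q * Y) * B))) =
      T * P * (q * e * ((1 - p * X⁻¹) * A * ((1 - p * Y⁻¹) * B))) := by
  have g1 : 1 - q * X = -(q * X) * (1 - p * X⁻¹) := by
    have : p * X⁻¹ * (q * X) = 1 := by rw [mul_mul_mul_comm, hq, inv_mul_cancel₀ hX, one_mul]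
    linear_combination -this
  have g2 : 1 - q * Y = -(q * Y) * (1 - p * Y⁻¹) := by
    have : p * Y⁻¹ * (q * Y) = 1 := by rw [mul_mul_mul_comm, hq, inv_mul_cancel₀ hY, one_mul]
    linear_combination -this
  rw [g1, g2]
  linear_combination (-(P * q * (1 - p * X⁻¹) * A * (1 - p * Y⁻¹) * B)) * h1

theorem evolMer_eq_translate {ε M : ℂ} (hN : 2 ≤ N) (hL : 2 ≤ L) (hh : h ≠ 0) (hε : ε ≠ 0)
    (hM : M ≠ 0) (Ψ : DilogSolution h) (i l : ℤ) :
    evolMer ε M Ψ = Mer.translate ((2 : ℂ) • bracketVec N L h i (2 * l - 1)) (evolMer ε M Ψ) *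
      sigmaFactor ε M h i l := by
  have h1 := translate_exp_quadForm (ε := ε) (M := M) hN hL hh hε hM i l
  have h2 := prod_dilogMer_eq_translate ε M hN hL Ψ i l
  rw [evolMer, map_mul, sigmaFactor]
  refine (congrArg (algebraMap _ _ (Entire.exp (h⁻¹ • quadForm N L)) * ·) h2).trans ?_
  beta_reduce
  have x1 := chiMer_ne_zero ε M ((i : ZMod N), (l : ZMod L))
  have x3 := chiMer_ne_zero ε M ((i : ZMod N), ((l - 1 : ℤ) : ZMod L))
  simp only [Algebra.smul_def (A := Mer (Phase N L))] at h1 ⊢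
  have hq : algebraMap ℂ (Mer (Phase N L)) ((Complex.exp h)⁻¹ ^ 2) *
      algebraMap ℂ (Mer (Phase N L)) (Complex.exp (2 * h)) = 1 := by
    rw [← map_mul, two_mul, Complex.exp_add, ← map_one (algebraMap ℂ (Mer (Phase N L)))]
    congr 1
    field_simp
  have hq' : algebraMap ℂ (Mer (Phase N L)) (Complex.exp h ^ 2 * (ε * M) ^ 4) =
      algebraMap ℂ (Mer (Phase N L)) (Complex.exp (2 * h)) *
        algebraMap ℂ (Mer (Phase N L)) ((ε * M) ^ 4) := by
    rw [← map_mul, two_mul, Complex.exp_add, sq]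
  rw [hq']
  exact factor_identity x1 x3 h1 hq

end Dilogarithm

end Toda

/-! ### Conjugation by units, and the action of `U` on the generators -/

/-- Conjugation `x ↦ u⁻¹ x u` by a unit. -/
def AlgEquiv.conjUnit {R A : Type*} [CommSemiring R] [Semiring A] [Algebra R A] (u : Aˣ) :
    A ≃ₐ[R] A where
  toFun x := ↑u⁻¹ * x * u
  invFun x := u * x * ↑u⁻¹
  left_inv x := by simp [mul_assoc]
  right_inv x := by simp [mul_assoc]
  map_mul' x y := by simp [mul_assoc]
  map_add' x y := by simp [mul_add, add_mul]
  commutes' r := by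
    rw [← Algebra.commutes, mul_assoc, Units.inv_mul, mul_one]

/-- `Ring.inverse` is 0 at a non-unit, whose image may be a unit; hence the hypothesis `hx`. -/
theorem map_ringInverse {R A B : Type*} [CommSemiring R] [Semiring A] [Semiring B] [Algebra R A]
    [Algebra R B] (f : A →ₐ[R] B) {x : A} (hx : IsUnit x) :
    f (Ring.inverse x) = Ring.inverse (f x) := by
  obtain ⟨u, rfl⟩ := hx
  have : f u = (u.map (f : A →* B) : Bˣ) := rfl
  rw [this, Ring.inverse_unit, Ring.inverse_unit]
  rfl

namespace Toda

section Conjugation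

variable {N L : ℕ} [NeZero N] [NeZero L] {h : ℂ}

/-- Algebra maps out of `C'_q(N, L)` are determined on the functions of each parity. -/
theorem algHom_ext {A : Type*} [Semiring A] [Algebra ℂ A] {f g : Cq N L h →ₐ[ℂ] A}
    (hfg : ∀ p a, f (fn N L h p a) = g (fn N L h p a)) : f = g := by
  apply RingQuot.ringQuot_ext'
  apply FreeAlgebra.hom_ext
  funext a
  exact hfg a.1 a.2

theorem isUnit_fn (p : ZMod 2) {f : Mer (Phase N L)} (hf : f ≠ 0) : IsUnit (fn N L h p f) :=
  (isUnit_iff_ne_zero.mpr hf).map (fn N L h p)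

theorem inverse_fn (p : ZMod 2) {f : Mer (Phase N L)} (hf : f ≠ 0) :
    Ring.inverse (fn N L h p f) = fn N L h p f⁻¹ := by
  rw [← map_ringInverse _ (isUnit_iff_ne_zero.mpr hf), Ring.inverse_eq_inv']

/-- The exchange relation for meromorphic functions. -/
theorem fn_exchange_mer (j m : ℤ) (t : ℂ) (f : Mer (Phase N L)) :
    fn N L h ((m : ZMod 2) + 1) f *
        fn N L h (m : ZMod 2) (algebraMap _ _ (Entire.exp (t • psiFun N L j m))) =
      fn N L h (m : ZMod 2) (algebraMap _ _ (Entire.exp (t • psiFun N L j m))) *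
        fn N L h ((m : ZMod 2) + 1) (Mer.translate (t • bracketVec N L h j m) f) := by
  obtain ⟨a, b, hb, rfl⟩ := IsFractionRing.div_surjective (A := Entire (Phase N L)) f
  have hb0 : algebraMap _ (Mer (Phase N L)) b ≠ 0 :=
    Mer.algebraMap_ne_zero (nonZeroDivisors.ne_zero hb)
  have ha := fn_exchange N L h j m t a
  have hb' := fn_exchange N L h j m t b
  rw [← Mer.translate_algebraMap] at ha hb'
  generalize fn N L h (m : ZMod 2) (algebraMap _ _ (Entire.exp (t • psiFun N L j m))) = E at *
  generalize Mer.translate (t • bracketVec N L h j m) = T at *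
  have hT : T (algebraMap _ _ b) ≠ 0 := (map_ne_zero T).mpr hb0
  -- The relation $bE=E\,T(b)$ for entire $b$ gives $b^{-1}E=E\,T(b)^{-1}$ by multiplying with the
  -- inverses on both sides.
  have hbi : fn N L h ((m : ZMod 2) + 1) (algebraMap _ _ b)⁻¹ * E =
      E * fn N L h ((m : ZMod 2) + 1) (T (algebraMap _ _ b))⁻¹ := by
    calc _ = fn N L h ((m : ZMod 2) + 1) (algebraMap _ _ b)⁻¹ *
          (E * fn N L h ((m : ZMod 2) + 1) (T (algebraMap _ _ b))) *
            fn N L h ((m : ZMod 2) + 1) (T (algebraMap _ _ b))⁻¹ := by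
          simp only [mul_assoc, ← map_mul, mul_inv_cancel₀ hT, map_one, mul_one]
      _ = _ := by
          rw [← hb', ← mul_assoc, ← map_mul, inv_mul_cancel₀ hb0, map_one, one_mul]
  rw [div_eq_mul_inv, map_mul, map_mul, map_inv₀ T, map_mul, mul_assoc, hbi, ← mul_assoc, ha,
    mul_assoc]

theorem chi_eq_fn {ε M : ℂ} (hε : ε ≠ 0) (hM : M ≠ 0) (i n : ℤ) :
    chi N L h ε M i n =
      fn N L h (n : ZMod 2) (chiMer ε M ((i : ZMod N), (half n : ZMod L))) := by
  rw [chi, chiMer, exp_logCoord hε hM, algebraMap_smul', map_smul, psiFun_eq_coord]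

theorem chi_even {ε M : ℂ} (hε : ε ≠ 0) (hM : M ≠ 0) (i l : ℤ) :
    chi N L h ε M i (2 * l) = fn N L h 0 (chiMer ε M ((i : ZMod N), (l : ZMod L))) := by
  rw [chi_eq_fn hε hM, half_two_mul, (ZMod.intCast_eq_zero_iff_even).mpr (even_two_mul l)]

theorem cast_two_mul_sub_one (l : ℤ) : ((2 * l - 1 : ℤ) : ZMod 2) = 1 :=
  (ZMod.intCast_eq_one_iff_odd).mpr ⟨l - 1, by ring⟩

/-- Conjugation by a function of the even variables multiplies `χ_i(2 l - 1)` by a function of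
the even variables. -/
theorem conj_chi_odd (ε M : ℂ) (i l : ℤ) {u r : Mer (Phase N L)} (hu : u ≠ 0)
    (hr : u = Mer.translate ((2 : ℂ) • bracketVec N L h i (2 * l - 1)) u * r) :
    Ring.inverse (fn N L h 0 u) * chi N L h ε M i (2 * l - 1) * fn N L h 0 u =
      chi N L h ε M i (2 * l - 1) * fn N L h 0 r := by
  -- With $T$ the translation, $u^{-1}\chi u=\chi\,(Tu)^{-1}u=\chi r$.
  have hx := fn_exchange_mer (N := N) (L := L) (h := h) i (2 * l - 1) 2 u⁻¹
  rw [cast_two_mul_sub_one, show (1 : ZMod 2) + 1 = 0 from rfl,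
    map_inv₀ (Mer.translate ((2 : ℂ) • bracketVec N L h i (2 * l - 1)))] at hx
  have hT : Mer.translate ((2 : ℂ) • bracketVec N L h i (2 * l - 1)) u ≠ 0 :=
    (map_ne_zero _).mpr hu
  rw [inverse_fn 0 hu, chi, mul_smul_comm, smul_mul_assoc, smul_mul_assoc, cast_two_mul_sub_one,
    hx, mul_assoc, ← map_mul]
  nth_rewrite 2 [hr]
  rw [inv_mul_cancel_left₀ hT]

theorem sigmaChi_odd {ε M : ℂ} (hN : 2 ≤ N) (hL : 2 ≤ L) (hε : ε ≠ 0) (hM : M ≠ 0) (i l : ℤ) :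
    sigmaChi N L h ε M i (2 * l - 1) =
      chi N L h ε M i (2 * l - 1) * fn N L h 0 (sigmaFactor ε M h i l) := by
  have ho : ¬ Even (2 * l - 1) := Int.not_even_iff_odd.mpr ⟨l - 1, by ring⟩
  simp only [sigmaChi]
  rw [if_neg ho, show 2 * l - 1 + 1 = 2 * l by ring, show 2 * l - 1 - 1 = 2 * (l - 1) by ring]
  simp only [chi_even hε hM, inverse_fn 0 (chiMer_ne_zero ε M _)]
  simp only [← map_one (fn N L h 0), ← map_smul, ← map_sub,
    inverse_fn 0 (one_sub_chiMer_ne_zero ε M hN hL _)]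
  rw [sigmaFactor, map_smul, map_mul, map_mul, map_mul, mul_smul_comm, mul_assoc]

/-- Conjugation by `U` is `σ` on the generators. -/
theorem conj_evolU_chi {ε M : ℂ} (hN : 2 ≤ N) (hL : 2 ≤ L) (hh : h ≠ 0) (hε : ε ≠ 0) (hM : M ≠ 0)
    (Ψ : DilogSolution h) (i n : ℤ) :
    Ring.inverse (evolU N L h ε M Ψ) * chi N L h ε M i n * evolU N L h ε M Ψ =
      sigmaChi N L h ε M i n := by
  have hu := evolMer_ne_zero (N := N) (L := L) ε M hN hL Ψ
  rw [evolU_eq]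
  rcases Int.even_or_odd n with hn | ⟨l, rfl⟩
  · rw [sigmaChi]
    simp only [hn, if_true]
    rw [inverse_fn 0 hu, chi_eq_fn hε hM, (ZMod.intCast_eq_zero_iff_even).mpr hn, ← map_mul,
      ← map_mul, mul_assoc, mul_comm, mul_assoc, mul_inv_cancel₀ hu, mul_one]
  · rw [show 2 * l + 1 = 2 * (l + 1) - 1 by ring, sigmaChi_odd hN hL hε hM,
      conj_chi_odd ε M i (l + 1) hu (evolMer_eq_translate hN hL hh hε hM Ψ i (l + 1))]

end Conjugation

/-! ### The maps `λ_±` and the element `V` -/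

section Shift

variable {N L : ℕ} [NeZero N] [NeZero L] {h : ℂ}

theorem lam_fn (e : ℤˣ) (p : ZMod 2) (f : Mer (Phase N L)) :
    lam N L h e (fn N L h p f) = fn N L h (p + 1) (Mer.pull (lamEquiv N L e p) f) := by
  have : fn N L h p f = RingQuot.mkAlgHom ℂ (Rel N L h) (FreeAlgebra.ι ℂ (p, f)) := rfl
  rw [this, lam, RingQuot.liftAlgHom_mkAlgHom_apply, FreeAlgebra.lift_ι_apply]
  rfl

/-- The two shifts of the index `k` cancel, and exactly one of the two parities passed through
carries the sign. -/
theorem lamEquiv_trans (e : ℤˣ) (p : ZMod 2) :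
    (lamEquiv N L e (p + 1)).trans (lamEquiv N L (-e) p) = ContinuousLinearEquiv.neg ℂ := by
  ext x a
  change (lamEquiv N L (-e) p (lamEquiv N L e (p + 1) x)).1 a = (-x).1 a
  obtain ⟨d, hd⟩ := odd_unit e
  have hx : ∀ c : ZMod L, c = 0 → x.1 (a.1, a.2 + c) = x.1 a := by
    rintro c rfl
    rw [add_zero]
  rw [lamEquiv_apply, lamEquiv_apply, add_assoc, ← Int.cast_add, Units.val_neg, hd]
  have hp : p = 0 ∨ p = 1 := by decide +revert
  rcases hp with rfl | rfl
  · rw [hx]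
    · simp
    · rw [show (0 : ZMod 2) + 1 = 1 from rfl, show ((1 : ZMod 2) + 1).val = 0 from rfl,
        show (1 : ZMod 2).val = 1 from rfl, show (0 : ZMod 2).val = 0 from rfl]
      rw [← Int.cast_zero]
      congr 1
      omega
  · rw [hx]
    · simp [show (1 : ZMod 2) + 1 = 0 from rfl]
    · rw [show (1 : ZMod 2) + 1 = 0 from rfl, show ((0 : ZMod 2) + 1).val = 1 from rfl,
        show (1 : ZMod 2).val = 1 from rfl, show (0 : ZMod 2).val = 0 from rfl]
      rw [← Int.cast_zero]
      congr 1
      omega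

theorem lam_lam_neg_fn (e : ℤˣ) (p : ZMod 2) (f : Mer (Phase N L)) :
    lam N L h e (lam N L h (-e) (fn N L h p f)) =
      fn N L h p (Mer.pull (ContinuousLinearEquiv.neg ℂ) f) := by
  rw [lam_fn, lam_fn, Mer.pull_pull, lamEquiv_trans, add_assoc, show (1 : ZMod 2) + 1 = 0 from rfl,
    add_zero]

/-- Both products are $\psi\mapsto-\psi$, which does not involve `e`. -/
theorem lam_lam_neg_comm (e : ℤˣ) (x : Cq N L h) :
    lam N L h e (lam N L h (-e) x) = lam N L h (-e) (lam N L h e x) := by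
  have : (lam N L h e).comp (lam N L h (-e)) = (lam N L h (-e)).comp (lam N L h e) := by
    refine algHom_ext fun p f => ?_
    have h1 := lam_lam_neg_fn (h := h) (-e) p f
    rw [neg_neg] at h1
    exact (lam_lam_neg_fn e p f).trans h1.symm
  exact DFunLike.congr_fun this x

theorem lam_lam_neg_involutive (e : ℤˣ) (x : Cq N L h) :
    lam N L h e (lam N L h (-e) (lam N L h e (lam N L h (-e) x))) = x := by
  have : ((lam N L h e).comp (lam N L h (-e))).comp ((lam N L h e).comp (lam N L h (-e))) =
      AlgHom.id ℂ _ := by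
    refine algHom_ext fun p f => ?_
    change lam N L h e (lam N L h (-e) (lam N L h e (lam N L h (-e) (fn N L h p f)))) =
      fn N L h p f
    rw [lam_lam_neg_fn, lam_lam_neg_fn, Mer.pull_pull]
    congr 1
    obtain ⟨a, b, _, rfl⟩ := IsFractionRing.div_surjective (A := Entire (Phase N L)) f
    rw [map_div₀, Mer.pull_algebraMap, Mer.pull_algebraMap]
    congr 2 <;> ext x <;> simp [Entire.pull]
  exact DFunLike.congr_fun this x

/-- The square of $\lambda_e\lambda_{-e}$ is the identity, which yields a left and a right inverse
of $\lambda_e$. -/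
theorem lam_bijective (e : ℤˣ) : Function.Bijective (lam N L h e) := by
  constructor
  · refine Function.LeftInverse.injective
      (g := fun x => lam N L h (-e) (lam N L h e (lam N L h (-e) x))) fun x => ?_
    have := lam_lam_neg_involutive (-e) x
    rwa [neg_neg] at this
  · exact fun x => ⟨_, lam_lam_neg_involutive e x⟩

/-- `λ_e` as an automorphism. -/
def lamAut (N L : ℕ) [NeZero N] [NeZero L] (h : ℂ) (e : ℤˣ) : Cq N L h ≃ₐ[ℂ] Cq N L h :=
  AlgEquiv.ofBijective (lam N L h e) (lam_bijective e)

/-- Consequently $-(\varepsilon M)^2e^{-2\psi}=(\varepsilon M)^4\chi^{-1}$, which is the origin of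
the constant in $\lambda_\pm(\chi)$. -/
theorem chi_mul_exp_neg (ε M : ℂ) {i n : ℤ} :
    chi N L h ε M i n *
      fn N L h (n : ZMod 2) (algebraMap _ _ (Entire.exp ((-2 : ℂ) • psiFun N L i n))) =
      algebraMap ℂ _ (-((ε * M) ^ 2)) := by
  rw [chi, smul_mul_assoc, ← map_mul, ← map_mul, ← Entire.exp_add, ← add_smul, add_neg_cancel,
    zero_smul]
  have : Entire.exp (0 : Entire (Phase N L)) = 1 := by
    ext x
    exact Complex.exp_zero
  rw [this, map_one, map_one, Algebra.algebraMap_eq_smul_one]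

theorem lam_chi {ε M : ℂ} (hε : ε ≠ 0) (hM : M ≠ 0) (e : ℤˣ) (i n : ℤ) :
    lam N L h e (chi N L h ε M i n) =
      if Even n then ((ε * M) ^ 4) • Ring.inverse (chi N L h ε M i (n + e))
      else chi N L h ε M i (n + e) := by
  have hl : lam N L h e (chi N L h ε M i n) = -((ε * M) ^ 2) • fn N L h ((n + e : ℤ) : ZMod 2)
      (algebraMap _ _ (Entire.exp ((2 * if (n : ZMod 2) = 0 then (-1 : ℂ) else 1) •
        psiFun N L i (n + e)))) := by
    rw [chi, map_smul, lam_fn, Mer.pull_algebraMap, pull_exp, map_smul, pull_psiFun, smul_smul,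
      cast_add_unit]
  rw [hl]
  split_ifs with h1 h2 h2
  · have hu : IsUnit (chi N L h ε M i (n + e)) := by
      rw [chi_eq_fn hε hM]
      exact isUnit_fn _ (chiMer_ne_zero ε M _)
    apply hu.mul_left_cancel
    rw [mul_smul_comm, mul_smul_comm, Ring.mul_inverse_cancel _ hu,
      show (2 : ℂ) * -1 = -2 by ring, chi_mul_exp_neg, Algebra.algebraMap_eq_smul_one, smul_smul]
    congr 1
    ring
  · exact absurd ((ZMod.intCast_eq_zero_iff_even).mp h1) h2
  · exact absurd ((ZMod.intCast_eq_zero_iff_even).mpr h2) h1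
  · rw [mul_one, chi]

theorem coord_lamEquiv_zero (e : ℤˣ) (x : Phase N L) (a : ZMod N × ZMod L) :
    (lamEquiv N L e 0 x).1 a =
      -x.1 (a.1, a.2 + ((((e : ℤ) - ((0 : ZMod 2).val : ℤ) + ((0 + 1 : ZMod 2).val : ℤ)) / 2 : ℤ) :
        ZMod L)) := by
  rw [lamEquiv_apply, if_pos rfl, neg_one_mul]

/-- `V` does not depend on the direction of the shift. -/
theorem pull_evolMer (ε M : ℂ) (Ψ : DilogSolution h) (e : ℤˣ) :
    Mer.pull (lamEquiv N L e 0) (evolMer (N := N) (L := L) ε M Ψ) =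
      Mer.pull (ContinuousLinearEquiv.neg ℂ) (evolMer (N := N) (L := L) ε M Ψ) := by
  set c : ZMod L := ((((e : ℤ) - ((0 : ZMod 2).val : ℤ) + ((0 + 1 : ZMod 2).val : ℤ)) / 2 : ℤ) :
    ZMod L)
  -- On even variables $\lambda_e$ is negation composed with a shift depending on `e`. The shift is
  -- invisible: $H$ is shift invariant, and the dilogarithm product is reindexed.
  have hT : ∀ x : Phase N L, lamEquiv N L e 0 x = -shiftEquiv N L c x := by
    intro x
    ext a
    exact coord_lamEquiv_zero e x a
  have hD : ∀ a, Mer.pull (lamEquiv N L e 0) (dilogMer ε M Ψ 0 a) =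
      Mer.pull (ContinuousLinearEquiv.neg ℂ) (dilogMer ε M Ψ 0 (a.1, a.2 + c)) := by
    intro a
    have hl : Entire.pull (lamEquiv N L e 0) (logCoord ε M 0 a) =
        Entire.pull (ContinuousLinearEquiv.neg ℂ) (logCoord ε M 0 (a.1, a.2 + c)) := by
      ext x
      change Complex.log (-((ε * M) ^ 2)) + 0 + 2 * (lamEquiv N L e 0 x).1 a =
        Complex.log (-((ε * M) ^ 2)) + 0 + 2 * (-x).1 (a.1, a.2 + c)
      rw [hT]
      rfl
    have hG : ∀ (G : ℂ → ℂ) (hG : Differentiable ℂ G),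
        Entire.pull (lamEquiv N L e 0) (Entire.comp G hG (logCoord ε M 0 a)) =
        Entire.pull (ContinuousLinearEquiv.neg ℂ)
          (Entire.comp G hG (logCoord ε M 0 (a.1, a.2 + c))) :=
      fun G hG => congrArg (Entire.comp G hG) hl
    rw [dilogMer, dilogMer, map_div₀, map_div₀]
    simp only [Mer.pull_algebraMap, hG]
  have hE : Entire.pull (lamEquiv N L e 0) (Entire.exp (h⁻¹ • quadForm N L)) =
      Entire.pull (ContinuousLinearEquiv.neg ℂ) (Entire.exp (h⁻¹ • quadForm N L)) := by
    ext x
    change Complex.exp (h⁻¹ * (quadForm N L).1 (lamEquiv N L e 0 x)) =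
      Complex.exp (h⁻¹ * (quadForm N L).1 (-x))
    rw [hT, quadForm_neg, quadForm_neg, quadForm_comp_shift]
  rw [evolMer, map_mul, map_mul, Mer.pull_algebraMap, Mer.pull_algebraMap, hE, map_prod, map_prod]
  congr 1
  simp only [hD]
  exact Fintype.prod_equiv ((Equiv.refl (ZMod N)).prodCongr (Equiv.addRight c)) _ _ fun _ => rfl

theorem lam_evolU (ε M : ℂ) (Ψ : DilogSolution h) (e : ℤˣ) :
    lam N L h e (evolU N L h ε M Ψ) = lam N L h 1 (evolU N L h ε M Ψ) := by
  rw [evolU_eq, lam_fn, lam_fn, pull_evolMer, pull_evolMer]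

end Shift

end Toda

/-! ### The maps `κ_±` and their trajectories -/

theorem ringInverse_mul_eq {A : Type*} [Ring A] {v u : A} (hv : IsUnit v) (hu : IsUnit u) :
    Ring.inverse (v * u) = Ring.inverse u * Ring.inverse v := by
  obtain ⟨v, rfl⟩ := hv
  obtain ⟨u, rfl⟩ := hu
  rw [← Units.val_mul, Ring.inverse_unit, Ring.inverse_unit, Ring.inverse_unit, mul_inv_rev,
    Units.val_mul]

theorem AlgEquiv.conjUnit_unit_apply {R A : Type*} [CommSemiring R] [Ring A] [Algebra R A] {u : A}
    (hu : IsUnit u) (x : A) :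
    AlgEquiv.conjUnit (R := R) hu.unit x = Ring.inverse u * x * u := by
  have h : Ring.inverse u = ((hu.unit⁻¹ : Aˣ) : A) := Ring.inverse_unit hu.unit
  rw [h]
  rfl

namespace Toda

section Maps

variable {N L : ℕ} [NeZero N] [NeZero L] {h ε M : ℂ}

theorem isUnit_chi (hε : ε ≠ 0) (hM : M ≠ 0) (i n : ℤ) : IsUnit (chi N L h ε M i n) := by
  rw [chi_eq_fn hε hM]
  exact isUnit_fn _ (chiMer_ne_zero ε M _)

theorem isUnit_one_sub_chi (hN : 2 ≤ N) (hL : 2 ≤ L) (hε : ε ≠ 0) (hM : M ≠ 0) (i n : ℤ) :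
    IsUnit (1 - chi N L h ε M i n) := by
  rw [chi_eq_fn hε hM, ← map_one (fn N L h (n : ZMod 2)), ← map_sub]
  exact isUnit_fn _ (one_sub_chiMer_ne_zero ε M hN hL _)

theorem isUnit_one_sub_smul_inverse_chi (hN : 2 ≤ N) (hL : 2 ≤ L) (hε : ε ≠ 0) (hM : M ≠ 0)
    (i n : ℤ) :
    IsUnit (1 - ((Complex.exp h)⁻¹ ^ 2) • Ring.inverse (chi N L h ε M i n)) := by
  rw [chi_eq_fn hε hM, inverse_fn _ (chiMer_ne_zero ε M _), ← map_one (fn N L h (n : ZMod 2)),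
    ← map_smul, ← map_sub]
  exact isUnit_fn _ (one_sub_smul_inv_chiMer_ne_zero ε M hN hL
    (pow_ne_zero 2 (inv_ne_zero (Complex.exp_ne_zero h))) _)

theorem isUnit_evolU (hN : 2 ≤ N) (hL : 2 ≤ L) (Ψ : DilogSolution h) :
    IsUnit (evolU N L h ε M Ψ) := by
  rw [evolU_eq]
  exact isUnit_fn 0 (evolMer_ne_zero ε M hN hL Ψ)

theorem sigmaFactor_ne_zero (hN : 2 ≤ N) (hL : 2 ≤ L) (hε : ε ≠ 0) (hM : M ≠ 0) (i l : ℤ) :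
    sigmaFactor (N := N) (L := L) ε M h i l ≠ 0 := by
  have hq := Complex.exp_ne_zero h
  have hq' : (Complex.exp h)⁻¹ ^ 2 ≠ 0 := pow_ne_zero 2 (inv_ne_zero hq)
  rw [sigmaFactor]
  exact smul_ne_zero (mul_ne_zero (pow_ne_zero 2 hq) (pow_ne_zero 4 (mul_ne_zero hε hM)))
    (mul_ne_zero (mul_ne_zero (one_sub_smul_inv_chiMer_ne_zero ε M hN hL hq' _)
      (inv_ne_zero (one_sub_chiMer_ne_zero ε M hN hL _)))
    (mul_ne_zero (one_sub_smul_inv_chiMer_ne_zero ε M hN hL hq' _)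
      (inv_ne_zero (one_sub_chiMer_ne_zero ε M hN hL _))))

/-- The value of $\kappa_\pm$ is $(\varepsilon M)^4$ times the inverse of the value of $\sigma$,
with the factors in reversed order; the scalars combine to $(\varepsilon M)^4/(q^2(\varepsilon
M)^4)=q^{-2}$. -/
theorem kappaChi_odd (hN : 2 ≤ N) (hL : 2 ≤ L) (hε : ε ≠ 0) (hM : M ≠ 0) (i l : ℤ) :
    kappaChi N L h ε M i (2 * l - 1) =
      ((ε * M) ^ 4) • (fn N L h 0 (sigmaFactor ε M h i l)⁻¹ *
        Ring.inverse (chi N L h ε M i (2 * l - 1))) := by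
  have ho : ¬ Even (2 * l - 1) := Int.not_even_iff_odd.mpr ⟨l - 1, by ring⟩
  have hq' : (Complex.exp h)⁻¹ ^ 2 ≠ 0 := pow_ne_zero 2 (inv_ne_zero (Complex.exp_ne_zero h))
  simp only [kappaChi]
  rw [if_neg ho, show 2 * l - 1 + 1 = 2 * l by ring, show 2 * l - 1 - 1 = 2 * (l - 1) by ring]
  simp only [chi_even hε hM, inverse_fn 0 (chiMer_ne_zero ε M _)]
  simp only [← map_one (fn N L h 0), ← map_smul, ← map_sub,
    inverse_fn 0 (one_sub_smul_inv_chiMer_ne_zero ε M hN hL hq' _)]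
  rw [← map_mul, ← map_mul, ← map_mul, ← smul_mul_assoc, ← smul_mul_assoc, ← map_smul, ← map_smul]
  congr 2
  have hc : ((ε * M) ^ 4) * (Complex.exp h ^ 2 * (ε * M) ^ 4)⁻¹ = (Complex.exp h)⁻¹ ^ 2 := by
    have := mul_ne_zero hε hM
    have := Complex.exp_ne_zero h
    field_simp
  have hsmul : ∀ (c : ℂ) (x : Mer (Phase N L)), (c • x)⁻¹ = c⁻¹ • x⁻¹ := fun c x => by
    rw [Algebra.smul_def, Algebra.smul_def, mul_inv, map_inv₀]
  rw [sigmaFactor, hsmul, smul_smul, hc]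
  simp only [mul_inv, inv_inv]
  congr 1
  ring

/-- `σ ∘ λ_e` takes the values of `κ_e` on the generators. -/
theorem conj_lam_chi (hN : 2 ≤ N) (hL : 2 ≤ L) (hε : ε ≠ 0) (hM : M ≠ 0)
    {σ : Cq N L h →ₐ[ℂ] Cq N L h}
    (hσ : ∀ i n, σ (chi N L h ε M i n) = sigmaChi N L h ε M i n) (e : ℤˣ) (i n : ℤ) :
    σ (lam N L h e (chi N L h ε M i (n - e))) = kappaChi N L h ε M i n := by
  have hpar : Even (n - (e : ℤ)) ↔ ¬ Even n := by
    have := odd_unit e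
    rw [Int.even_sub, ← Int.not_odd_iff_even (n := (e : ℤ))]
    simp [this]
  rw [lam_chi hε hM, sub_add_cancel]
  -- For `n` even, $\lambda_e$ gives $\chi_i(n)$, which $\sigma$ fixes. For `n` odd it gives
  -- $(\varepsilon M)^4\chi_i^{-1}(n)$, and $\sigma$ inverts the product of $\chi_i(n)$ and its
  -- factor.
  by_cases hn : Even n
  · rw [if_neg (by rw [hpar]; exact not_not.mpr hn), hσ, sigmaChi, kappaChi]
    simp only [hn, if_true]
  · rw [if_pos (hpar.mpr hn)]
    obtain ⟨l, rfl⟩ := Int.not_even_iff_odd.mp hn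
    rw [show 2 * l + 1 = 2 * (l + 1) - 1 by ring, map_smul,
      map_ringInverse σ (isUnit_chi hε hM i _), hσ, sigmaChi_odd hN hL hε hM,
      kappaChi_odd hN hL hε hM]
    have h1 := isUnit_chi (N := N) (L := L) (h := h) hε hM i (2 * (l + 1) - 1)
    have h2 := sigmaFactor_ne_zero (N := N) (L := L) (h := h) hN hL hε hM i (l + 1)
    have h3 := isUnit_fn (h := h) 0 h2
    congr 1
    rw [← inverse_fn 0 h2]
    obtain ⟨u, hu⟩ := h1
    obtain ⟨v, hv⟩ := h3
    rw [← hu, ← hv, ← Units.val_mul, Ring.inverse_unit, Ring.inverse_unit, Ring.inverse_unit,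
      mul_inv_rev, Units.val_mul]

theorem lam_lam_neg_chi (hε : ε ≠ 0) (hM : M ≠ 0) (i n : ℤ) :
    lam N L h 1 (lam N L h (-1) (chi N L h ε M i n)) =
      ((ε * M) ^ 4) • Ring.inverse (chi N L h ε M i n) := by
  rw [lam_chi hε hM]
  have he : ∀ e : ℤˣ, Even (n + (e : ℤ)) ↔ ¬ Even n := fun e => by
    rw [Int.even_add, ← Int.not_odd_iff_even (n := (e : ℤ))]
    simp [odd_unit e]
  have hn : n + ((-1 : ℤˣ) : ℤ) + ((1 : ℤˣ) : ℤ) = n := by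
    rw [Units.val_neg, neg_add_cancel_right]
  by_cases h1 : Even n
  · rw [if_pos h1, map_smul, map_ringInverse _ (isUnit_chi hε hM _ _), lam_chi hε hM,
      if_neg (by rw [he]; exact not_not.mpr h1), hn]
  · rw [if_neg h1, lam_chi hε hM, if_pos ((he _).mpr h1), hn]

/-- Algebra maps that agree on the generators agree on the values of `κ_±`. -/
theorem map_kappaChi_congr (hN : 2 ≤ N) (hL : 2 ≤ L) (hε : ε ≠ 0) (hM : M ≠ 0)
    {f g : Cq N L h →ₐ[ℂ] Cq N L h}
    (hfg : ∀ i n, f (chi N L h ε M i n) = g (chi N L h ε M i n)) (i n : ℤ) :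
    f (kappaChi N L h ε M i n) = g (kappaChi N L h ε M i n) := by
  have hi : ∀ i n, f (Ring.inverse (chi N L h ε M i n)) = g (Ring.inverse (chi N L h ε M i n)) := by
    intro i n
    rw [map_ringInverse _ (isUnit_chi hε hM i n), map_ringInverse _ (isUnit_chi hε hM i n), hfg]
  have hj : ∀ i n,
      f (Ring.inverse (1 - ((Complex.exp h)⁻¹ ^ 2) • Ring.inverse (chi N L h ε M i n))) =
      g (Ring.inverse (1 - ((Complex.exp h)⁻¹ ^ 2) • Ring.inverse (chi N L h ε M i n))) := by
    intro i n
    -- Algebra maps are only known to respect `Ring.inverse` at units, so invertibility of each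
    -- denominator is needed.
    have hu := isUnit_one_sub_smul_inverse_chi (N := N) (L := L) (h := h) hN hL hε hM i n
    rw [map_ringInverse _ hu, map_ringInverse _ hu, map_sub, map_sub, map_smul, map_smul, hi,
      map_one, map_one]
  simp only [kappaChi]
  split_ifs
  · exact hfg i n
  · simp only [map_smul, map_mul, map_sub, map_one, hfg, hi, hj]

/-- The two products of maps with the values of `κ_±` on the generators are determined on the
generators. -/
theorem comp_kappa_congr (hN : 2 ≤ N) (hL : 2 ≤ L) (hε : ε ≠ 0) (hM : M ≠ 0)
    {κ κ' : ℤˣ → Cq N L h →ₐ[ℂ] Cq N L h}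
    (hκ : ∀ (e : ℤˣ) (i n : ℤ), κ e (chi N L h ε M i (n - e)) = kappaChi N L h ε M i n)
    (hκ' : ∀ (e : ℤˣ) (i n : ℤ), κ' e (chi N L h ε M i (n - e)) = kappaChi N L h ε M i n)
    (d e : ℤˣ) (i n : ℤ) :
    κ d (κ e (chi N L h ε M i n)) = κ' d (κ' e (chi N L h ε M i n)) := by
  have hk : ∀ (e : ℤˣ) (i n : ℤ), κ e (chi N L h ε M i n) = κ' e (chi N L h ε M i n) := by
    intro e i n
    have h1 := hκ e i (n + e)
    have h2 := hκ' e i (n + e)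
    rw [add_sub_cancel_right] at h1 h2
    rw [h1, h2]
  have h2 := hκ' e i (n + e)
  rw [add_sub_cancel_right] at h2
  rw [hk, h2]
  exact map_kappaChi_congr hN hL hε hM (hk d) i (n + e)

/-- Commuting automorphisms that act on the generators as `κ_±` have a trajectory. -/
theorem exists_isTrajectory (κ : ℤˣ → Cq N L h ≃ₐ[ℂ] Cq N L h)
    (hκ : ∀ (e : ℤˣ) (i n : ℤ), κ e (chi N L h ε M i (n - e)) = kappaChi N L h ε M i n)
    (hcomm : κ 1 * κ (-1) = κ (-1) * κ 1) :
    ∃ X, IsTrajectory N L h ε M (fun e => κ e) X := by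
  have hodd : ∀ (e : ℤˣ) (i n : ℤ), Odd n →
      κ e (chi N L h ε M i n) = chi N L h ε M i (n + e) := by
    intro e i n hn
    have h1 := hκ e i (n + e)
    rw [add_sub_cancel_right] at h1
    rw [h1, kappaChi]
    simp only [hn.add_odd (odd_unit e), if_true]
  have hprod : ∀ e : ℤˣ, κ 1 * κ (-1) = κ e * κ (-e) := by
    intro e
    rcases Int.units_eq_one_or e with rfl | rfl
    · rfl
    · rw [neg_neg, hcomm]
  have hce : ∀ e : ℤˣ, Commute (κ e) (κ 1 * κ (-1)) := by
    intro e
    rcases Int.units_eq_one_or e with rfl | rfl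
    · exact (Commute.refl _).mul_right hcomm
    · exact (Commute.mul_right hcomm.symm (Commute.refl _))
  -- Two time steps are one application of $\kappa_+\kappa_-$. With the floor of $t/2$ the exponent
  -- is 0 for both $t=0$ and $t=1$, which matches the initial data.
  refine ⟨fun i n t => ((κ 1 * κ (-1)) ^ (t / 2)) (chi N L h ε M i n), ?_, ?_, ?_⟩
  · intro i n t hnt e
    change ((κ 1 * κ (-1)) ^ ((t + 1) / 2)) (chi N L h ε M i (n + e)) =
      (κ e * (κ 1 * κ (-1)) ^ (t / 2)) (chi N L h ε M i n)
    rw [((hce e).zpow_right (t / 2)).eq]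
    rcases Int.even_or_odd t with ht | ht
    · have hn : Odd n := by
        rcases Int.even_or_odd n with hn | hn
        · exact absurd (hn.add ht) (Int.not_even_iff_odd.mpr hnt)
        · exact hn
      rw [AlgEquiv.mul_apply, hodd e i n hn]
      obtain ⟨a, rfl⟩ := ht
      rw [show (a + a + 1) / 2 = (a + a) / 2 by omega]
    · have hn : Even n := by
        rcases Int.even_or_odd n with hn | hn
        · exact hn
        · exact absurd (hn.add_odd ht) (Int.not_even_iff_odd.mpr hnt)
      -- From odd to even time the exponent increases by one; the extra power is
      -- $\kappa_e\kappa_{-e}$, obtained by writing $\chi_i(n)$, $n$ even, as the image of its odd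
      -- neighbour.
      have hne : chi N L h ε M i n = κ (-e) (chi N L h ε M i (n + e)) := by
        rw [hodd _ _ _ (hn.add_odd (odd_unit e)), Units.val_neg, add_neg_cancel_right]
      obtain ⟨a, rfl⟩ := ht
      rw [show (2 * a + 1 + 1) / 2 = (2 * a + 1) / 2 + 1 by omega, zpow_add_one]
      rw [AlgEquiv.mul_apply, AlgEquiv.mul_apply ((κ 1 * κ (-1)) ^ _), AlgEquiv.mul_apply, hne]
      rw [← AlgEquiv.mul_apply (κ 1), hprod e]
      rfl
  · intro i n _
    change ((κ 1 * κ (-1)) ^ ((1 : ℤ) / 2)) (chi N L h ε M i n) = chi N L h ε M i n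
    rw [show (1 : ℤ) / 2 = 0 from rfl, zpow_zero, AlgEquiv.one_apply]
  · intro i n _
    change ((κ 1 * κ (-1)) ^ ((0 : ℤ) / 2)) (chi N L h ε M i n) = chi N L h ε M i n
    rw [show (0 : ℤ) / 2 = 0 from rfl, zpow_zero, AlgEquiv.one_apply]

/-- The path of sites $n\to n-1\to n$ uses $\kappa_-$ and then $\kappa_+$. -/
theorem IsTrajectory.add_two {κ : ℤˣ → Cq N L h → Cq N L h} {X : ℤ → ℤ → ℤ → Cq N L h}
    (hX : IsTrajectory N L h ε M κ X) {i n t : ℤ} (hnt : Odd (n + t)) :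
    X i n (t + 2) = κ 1 (κ (-1) (X i n t)) := by
  have h1 := hX.1 i n t hnt (-1)
  have h2 := hX.1 i (n + ((-1 : ℤˣ) : ℤ)) (t + 1) (by
    rw [Units.val_neg, Units.val_one, show n + -1 + (t + 1) = n + t by ring]
    exact hnt) 1
  rw [← h1, ← h2, Units.val_neg, Units.val_one, show n + -1 + 1 = n by ring,
    show t + 1 + 1 = t + 2 by ring]

end Maps

end Toda

end

/-! ### The proposition -/

theorem mainTheorem4 (N L : ℕ) [NeZero N] [NeZero L] (hN : 2 ≤ N) (hL : 2 ≤ L)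
    (h ε M : ℂ) (hh : h ≠ 0) (hε : ε ≠ 0) (hM : M ≠ 0) (Ψ : Toda.DilogSolution h) :
    let χ := Toda.chi N L h ε M
    let U := Toda.evolU N L h ε M Ψ
    let lam := Toda.lam N L h
    let V := lam 1 U
    let W := V * U
    -- the elements that are inverted are invertible
    (∀ i n : ℤ, IsUnit (χ i n) ∧ IsUnit (1 - χ i n) ∧
      IsUnit (1 - ((Complex.exp h)⁻¹ ^ 2) • Ring.inverse (χ i n))) ∧
    IsUnit U ∧ IsUnit W ∧
    -- conjugation by `U` is `σ`
    (∀ i n : ℤ, Ring.inverse U * χ i n * U = Toda.sigmaChi N L h ε M i n) ∧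
    -- `λ_±` on the generators, and their product `λ`
    (∀ (e : ℤˣ) (i n : ℤ), lam e (χ i n) =
      if Even n then ((ε * M) ^ 4) • Ring.inverse (χ i (n + e)) else χ i (n + e)) ∧
    lam (-1) U = V ∧
    (∀ x, lam 1 (lam (-1) x) = lam (-1) (lam 1 x)) ∧
    (∀ i n : ℤ, lam 1 (lam (-1) (χ i n)) = ((ε * M) ^ 4) • Ring.inverse (χ i n)) ∧
    -- the automorphisms `σ`, `κ_± = σ ∘ λ_±` and the evolution operator
    (∃ (σ : Toda.Cq N L h ≃ₐ[ℂ] Toda.Cq N L h) (κ : ℤˣ → Toda.Cq N L h ≃ₐ[ℂ] Toda.Cq N L h),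
      (∀ x, σ x = Ring.inverse U * x * U) ∧
      (∀ i n : ℤ, σ (χ i n) = Toda.sigmaChi N L h ε M i n) ∧
      (∀ (e : ℤˣ) x, κ e x = σ (lam e x)) ∧
      (∀ (e : ℤˣ) (i n : ℤ), κ e (χ i (n - e)) = Toda.kappaChi N L h ε M i n) ∧
      (∀ x, κ 1 (κ (-1) x) = κ (-1) (κ 1 x)) ∧
      (∀ x, κ 1 (κ (-1) x) = Ring.inverse W * lam 1 (lam (-1) x) * W) ∧
      (∃ X, Toda.IsTrajectory N L h ε M (fun e => κ e) X) ∧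
      (∀ X, Toda.IsTrajectory N L h ε M (fun e => κ e) X →
        (∀ i n t : ℤ, Odd (n + t) →
          X i n (t + 2) = κ 1 (κ (-1) (X i n t)) ∧
          X i n (t + 2) = Ring.inverse W * lam 1 (lam (-1) (X i n t)) * W) ∧
        (∀ i n t : ℤ, Odd (n + t) → t = 0 ∨ t = 1 →
          X i n (t + 2) =
            ((ε * M) ^ 4) • (Ring.inverse W * Ring.inverse (X i n t) * W)))) ∧
    -- any endomorphisms with the values of `κ_±` on the generators have this evolution
    (∀ κ : ℤˣ → Toda.Cq N L h →ₐ[ℂ] Toda.Cq N L h,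
      (∀ (e : ℤˣ) (i n : ℤ), κ e (χ i (n - e)) = Toda.kappaChi N L h ε M i n) →
      ∀ i n : ℤ,
        κ 1 (κ (-1) (χ i n)) = κ (-1) (κ 1 (χ i n)) ∧
        κ 1 (κ (-1) (χ i n)) =
          ((ε * M) ^ 4) • (Ring.inverse W * Ring.inverse (χ i n) * W)) := by

  intro χ U lam V W
  have hU : IsUnit U := Toda.isUnit_evolU hN hL Ψ
  have hV : IsUnit V := hU.map (lam 1)
  have hW : IsUnit W := hV.mul hU
  have hlamU : ∀ e, lam e U = V := Toda.lam_evolU ε M Ψ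
  have hsigma : ∀ i n : ℤ, Ring.inverse U * χ i n * U = Toda.sigmaChi N L h ε M i n :=
    Toda.conj_evolU_chi hN hL hh hε hM Ψ
  have hcomm : ∀ x, lam 1 (lam (-1) x) = lam (-1) (lam 1 x) := Toda.lam_lam_neg_comm 1
  have hlam : ∀ i n : ℤ, lam 1 (lam (-1) (χ i n)) = ((ε * M) ^ 4) • Ring.inverse (χ i n) :=
    Toda.lam_lam_neg_chi hε hM
  let σ : Toda.Cq N L h ≃ₐ[ℂ] Toda.Cq N L h := AlgEquiv.conjUnit hU.unit
  have hσ : ∀ x, σ x = Ring.inverse U * x * U := AlgEquiv.conjUnit_unit_apply hU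
  have hσχ : ∀ i n : ℤ, σ (χ i n) = Toda.sigmaChi N L h ε M i n := fun i n =>
    (hσ _).trans (hsigma i n)
  let κ : ℤˣ → Toda.Cq N L h ≃ₐ[ℂ] Toda.Cq N L h := fun e => (Toda.lamAut N L h e).trans σ
  have hκ : ∀ (e : ℤˣ) x, κ e x = σ (lam e x) := fun _ _ => rfl
  have hκχ : ∀ (e : ℤˣ) (i n : ℤ), κ e (χ i (n - e)) = Toda.kappaChi N L h ε M i n :=
    Toda.conj_lam_chi (σ := (σ : Toda.Cq N L h →ₐ[ℂ] Toda.Cq N L h)) hN hL hε hM hσχ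
  -- $U^{-1}\lambda_d(U^{-1}\lambda_e(x)U)U=(VU)^{-1}\lambda_d\lambda_e(x)\,VU$, because
  -- $\lambda_d(U)=V$ for either sign `d`.
  have hκκ : ∀ (d e : ℤˣ) x, κ d (κ e x) = Ring.inverse W * lam d (lam e x) * W := by
    intro d e x
    rw [hκ, hκ, hσ, hσ, map_mul, map_mul, map_ringInverse _ hU, hlamU, ringInverse_mul_eq hV hU]
    simp only [mul_assoc, W]
  have hκ1 : ∀ x, κ 1 (κ (-1) x) = κ (-1) (κ 1 x) := fun x => by rw [hκκ, hκκ, hcomm]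
  have hκχχ : ∀ i n : ℤ, κ 1 (κ (-1) (χ i n)) =
      ((ε * M) ^ 4) • (Ring.inverse W * Ring.inverse (χ i n) * W) := fun i n => by
    rw [hκκ, hlam, mul_smul_comm, smul_mul_assoc]
  refine ⟨fun i n => ⟨Toda.isUnit_chi hε hM i n, Toda.isUnit_one_sub_chi hN hL hε hM i n,
    Toda.isUnit_one_sub_smul_inverse_chi hN hL hε hM i n⟩, hU, hW, hsigma, Toda.lam_chi hε hM,
    hlamU (-1), hcomm, hlam, ?_, ?_⟩
  · refine ⟨σ, κ, hσ, hσχ, hκ, hκχ, hκ1, hκκ 1 (-1),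
      Toda.exists_isTrajectory κ hκχ (AlgEquiv.ext hκ1), fun X hX => ⟨fun i n t hnt =>
        ⟨hX.add_two hnt, (hX.add_two hnt).trans (hκκ 1 (-1) _)⟩, fun i n t hnt ht => ?_⟩⟩
    -- At times 0 and 1 the trajectory consists of generators, on which $\lambda$ is known as
    -- $(\varepsilon M)^4\chi^{-1}$.
    have hXt : X i n t = χ i n := by
      rcases ht with rfl | rfl
      · exact hX.2.2 i n (by simpa using hnt)
      · exact hX.2.1 i n (by simpa [Int.odd_add] using hnt)
    rw [hX.add_two hnt, hXt]
    exact hκχχ i n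
  · intro κ' hκ' i n
    -- The given endomorphisms are compared with the automorphisms `κ` constructed above; they need
    -- agree only on generators and their two-step images.
    have hc := Toda.comp_kappa_congr (κ' := fun e => (κ e : Toda.Cq N L h →ₐ[ℂ] Toda.Cq N L h))
      hN hL hε hM hκ' hκχ
    refine ⟨(hc 1 (-1) i n).trans ((hκ1 _).trans (hc (-1) 1 i n).symm), ?_⟩
    exact (hc 1 (-1) i n).trans (hκχχ i n)
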